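/- **Conventions.** For a simplicial set $Z$, let $Z^{ND}_n$ be its set of non-degenerate $n$-simplices and let $C^{ND}_*(Z)$ be its normalized chain complex: $C^{ND}_n(Z)=\mathbb Z[Z^{ND}_n]$, with $d z=\sum_i(-1)^i\partial_i z$, where the degenerate faces are cancelled. The elements of $Z^{ND}_n$ are called the $n$-cells of $C^{ND}_*(Z)$. In a chain complex with distinguished bases of cells, a $(p-1)$-cell $\sigma$ is a face (resp. a regular face) of a $p$-cell $\tau$ if its coefficient in $d\tau$ is non-zero (resp. $\pm1$). A *discrete vector field* $V$ is a set of pairs $(\sigma,\tau)$ of cells, called vectors, such that $\sigma$ is a regular face of $\tau$ and every cell appears at most once in $V$. The first components are the *source* cells, the second components are the *target* cells, and the cells which do not appear in $V$ are the *critical* cells. A *$V$-path* of length $m$ starting from $\sigma_0$ is a sequence $(\sigma_k,\tau_k)_{0\le k<m}$ of vectors of $V$ such that, for $0<k<m$, $\sigma_k$ is a face of $\tau_{k-1}$ different from $\sigma_{k-1}$. $V$ is *admissible* if for every cell $\sigma$ the lengths of the $V$-paths starting from $\sigma$ are bounded. A *reduction* $\rho=(f,g,h):\widehat C_*\Rightarrow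 C_*$ consists of chain maps $f:\widehat C_*\to C_*$ and $g:C_*\to\widehat C_*$ and an operator $h:\widehat C_*\to\widehat C_{*+1}$ such that $fg=\mathrm{id}$, $gf+dh+hd=\mathrm{id}$, $fh=0$, $hg=0$, $hh=0$. For a discrete vector field $V$, decompose the chain groups and the differential $d=(d_{ij})$ according to (1) target, (2) source, (3) critical cells. The *W-reduction* induced by $V$, defined when every component $d_{21}$ is an isomorphism (as happens for $V$ admissible), is the reduction to the graded module generated by the critical cells (the critical complex) given by $$d'=d_{33}-d_{31}d_{21}^{-1}d_{23},\quad f=\begin{pmatrix}0&-d_{31}d_{21}^{-1}&1\end{pmatrix},\quad g=\begin{pmatrix}-d_{21}^{-1}d_{23}\\0\\1\end{pmatrix},\quad h=d_{21}^{-1}\text{ on the source cells, and }0\text{ on the other cells}.$$ An *s-path* of dimension $n$ in the lattice $[0..p]\times[0..q]$ is a strictly increasing sequence $\pi=((a_i,b_i))_{0\le i\le n}$ for the product order; it is *interior* if both projections $i\mapsto a_i$ and $i\mapsto b_i$ are surjective, and $\partial_k\pi$ is obtained by skipping the $k$-th point. For an interior s-path the steps are vertical ($(0,1)$), horizontal ($(1,0)$)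 or diagonal ($(1,1)$). Let $X$, $Y$ be simplicial sets, $\sigma\in X^{ND}_p$, $\tau\in Y^{ND}_q$. An s-path $\pi$ codes the $n$-simplex $\pi(\sigma,\tau)=(a^*\sigma,b^*\tau)$ of $X\times Y$. Every non-degenerate simplex $\rho$ of $X\times Y$ is $\pi(\sigma,\tau)$ for a unique triple $(\sigma,\tau,\pi)$ with $\sigma,\tau$ non-degenerate and $\pi$ interior: if $\rho=(\eta_{i_{s-1}}\cdots\eta_{i_0}\sigma,\eta_{j_{t-1}}\cdots\eta_{j_0}\tau)$ is the canonical writing of $\rho$, the indices $i_*$ (resp. $j_*$) of this degeneracy configuration are the indices of the vertical (resp. horizontal) steps of $\pi$. Run $\pi$ backward from $(p,q)$; an *event* is a diagonal step, or a point $(a_k,b_k)$ at which (in the forward direction) a vertical step is followed by a horizontal step. The s-path is a *source* if the first event met is a diagonal step, a *target* if it is such a bend, and *critical* if there is no event; the only critical interior s-path is then the last simplex $\lambda_{p,q}=((0,0),(1,0),\dots,(p,0),(p,1),\dots,(p,q))$. The *Eilenberg-Zilber vector field* $V_{X\times Y}$ is the set of the pairs $\big((\partial_k\pi)(\sigma,\tau),\,\pi(\sigma,\tau)\big)$,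 where $\sigma,\tau$ are non-degenerate simplices of $X$ and $Y$, $\pi$ is an interior target s-path, and $k$ is the index of the bend which is its first event. **Theorem 46504 (Eilenberg-Zilber Theorem).** Let $X$ and $Y$ be simplicial sets. Then $V_{X\times Y}$ is an admissible discrete vector field on $C^{ND}_*(X\times Y)$, and its source, target and critical cells are exactly the non-degenerate simplices of $X\times Y$ whose s-path is respectively source, target and critical. It induces a W-reduction $$EZ:\;C^{ND}_*(X\times Y)\Rightarrow C^{ND}_*(X)\otimes C^{ND}_*(Y),$$ where the critical complex is identified with the tensor product as follows: for $\sigma\in X^{ND}_p$ and $\tau\in Y^{ND}_q$ the critical cell $\lambda_{p,q}(\sigma,\tau)$ corresponds to the generator $\sigma\otimes\tau$, and this is an isomorphism of graded modules; the differential $d'$ of the critical complex is the standard one, $d(\sigma\otimes\tau)=d\sigma\otimes\tau+(-1)^p\sigma\otimes d\tau$. -/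

import Mathlib

open CategoryTheory Limits Simplicial MonoidalCategory TensorProduct

universe u

/-! ### Algebraic cellular complexes

The definitions are written over a commutative ring `k`; the theorem is about `k = ℤ`. -/

/-- An algebraic cellular complex: a chain complex of `k`-modules all of whose chain groups are
free with a distinguished `k`-basis, not assumed to be finite; the elements of the index set
`cell p` are the `p`-cells. All the complexes considered here live in degrees `p ≥ 0`. -/
structure AlgCellComplex (k : Type) [CommRing k] where
  /-- the underlying chain complex -/
  complex : ChainComplex (ModuleCat.{u} k) ℕ
  /-- the `p`-cells -/
  cell : ℕ → Type u
  /-- the distinguished basis of the group of `p`-chains -/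
  basis : ∀ p, Module.Basis (cell p) k (complex.X p)

namespace AlgCellComplex

variable {k : Type} [CommRing k] (C : AlgCellComplex.{u} k)

/-- The incidence number `ε(σ, τ)`: the coefficient of `σ` in `dτ`. -/
noncomputable def incidence {p : ℕ} (σ : C.cell p) (τ : C.cell (p + 1)) : k :=
  (C.basis p).repr ((C.complex.d (p + 1) p).hom (C.basis (p + 1) τ)) σ

/-- `σ` is a face of `τ`. -/
def IsFace {p : ℕ} (σ : C.cell p) (τ : C.cell (p + 1)) : Prop :=
  C.incidence σ τ ≠ 0

/-- `σ` is a regular face of `τ`. -/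
def IsRegularFace {p : ℕ} (σ : C.cell p) (τ : C.cell (p + 1)) : Prop :=
  C.incidence σ τ = 1 ∨ C.incidence σ τ = -1

/-! ### Discrete vector fields -/

/-- A collection of pairs `(σ, τ)` where `σ` is a `p`-cell and `τ` a `(p+1)`-cell:
`V p σ τ` means that `(σ, τ)` belongs to the collection. -/
abbrev PairField : Type u :=
  ∀ p : ℕ, C.cell p → C.cell (p + 1) → Prop

variable {C}

/-- The `p`-cells which are the first component of a pair of `V`. -/
def sources (V : C.PairField) (p : ℕ) : Set (C.cell p) :=
  {σ | ∃ τ, V p σ τ}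

/-- The `p`-cells which are the second component of a pair of `V`. -/
def targets (V : C.PairField) (p : ℕ) : Set (C.cell p) :=
  match p with
  | 0 => ∅
  | p + 1 => {τ | ∃ σ, V p σ τ}

/-- The critical `p`-cells: those which do not appear in `V`. -/
def criticals (V : C.PairField) (p : ℕ) : Set (C.cell p) :=
  (sources V p ∪ targets V p)ᶜ

/-- `V` is a discrete vector field: the first component of every vector is a regular face of the
second one, and every cell appears at most once in `V`. -/
structure IsDiscreteVectorField (V : C.PairField) : Prop where
  regular : ∀ (p : ℕ) (σ : C.cell p) (τ : C.cell (p + 1)), V p σ τ → C.IsRegularFace σ τ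
  target_unique : ∀ (p : ℕ) (σ : C.cell p) (τ τ' : C.cell (p + 1)),
    V p σ τ → V p σ τ' → τ = τ'
  source_unique : ∀ (p : ℕ) (σ σ' : C.cell p) (τ : C.cell (p + 1)),
    V p σ τ → V p σ' τ → σ = σ'
  disjoint : ∀ p : ℕ, Disjoint (sources V p) (targets V p)

/-- A `V`-path: a finite sequence of vectors `(σ_k, τ_k)` of `V` such that `σ_k` is a face of
`τ_{k-1}`, not necessarily regular, different from `σ_{k-1}`. -/
def IsVPath (V : C.PairField) {p : ℕ} (π : List (C.cell p × C.cell (p + 1))) : Prop :=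
  (∀ v ∈ π, V p v.1 v.2) ∧ π.IsChain (fun v w => C.IsFace w.1 v.2 ∧ w.1 ≠ v.1)

/-- `V` is admissible: the lengths of the `V`-paths which start from a given cell are bounded. -/
def IsAdmissible (V : C.PairField) : Prop :=
  ∀ p : ℕ, ∃ bd : C.cell p → ℕ,
    ∀ (v : C.cell p × C.cell (p + 1)) (π : List (C.cell p × C.cell (p + 1))),
      IsVPath V (v :: π) → (v :: π).length ≤ bd v.1

/-! ### Block decompositions -/

variable (C)

/-- The inclusion in the `p`-chains of the submodule generated by a set of `p`-cells. -/
noncomputable def incl {p : ℕ} (P : Set (C.cell p)) : (P →₀ k) →ₗ[k] C.complex.X p :=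
  Finsupp.linearCombination k (fun c : P => C.basis p c)

/-- The projection of the `p`-chains on the submodule generated by a set of `p`-cells. -/
noncomputable def proj {p : ℕ} (P : Set (C.cell p)) : C.complex.X p →ₗ[k] (P →₀ k) :=
  Finsupp.lsubtypeDomain P ∘ₗ (C.basis p).repr.toLinearMap

/-- The block of the differential which starts from the `(p+1)`-cells of `P` and arrives at the
`p`-cells of `Q`. -/
noncomputable def block {p : ℕ} (P : Set (C.cell (p + 1))) (Q : Set (C.cell p)) :
    (P →₀ k) →ₗ[k] (Q →₀ k) :=
  C.proj Q ∘ₗ (C.complex.d (p + 1) p).hom ∘ₗ C.incl P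

end AlgCellComplex

/-! ### Reductions -/

/-- A (homology) reduction of the chain complex `K` on the chain complex `L`: chain maps `f` and
`g` and a homotopy operator `h` of degree `+1` such that `fg = id`, `id = dh + hd + gf`, `fh = 0`,
`hg = 0` and `hh = 0`. -/
structure Reduction {k : Type} [CommRing k] (K L : ChainComplex (ModuleCat.{u} k) ℕ) where
  /-- the projection -/
  f : K ⟶ L
  /-- the injection -/
  g : L ⟶ K
  /-- the homotopy operator -/
  h : Homotopy (𝟙 K) (f ≫ g)
  g_comp_f : g ≫ f = 𝟙 L
  h_comp_f : ∀ i j : ℕ, h.hom i j ≫ f.f j = 0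
  g_comp_h : ∀ i j : ℕ, g.f i ≫ h.hom i j = 0
  h_comp_h : ∀ i j k : ℕ, h.hom i j ≫ h.hom j k = 0

/-- The identifications of the chain groups of a chain complex `L` with the free modules generated
by the critical cells of `V`. -/
abbrev CriticalIdentification {k : Type} [CommRing k] {C : AlgCellComplex.{u} k} (V : C.PairField)
    (L : ChainComplex (ModuleCat.{u} k) ℕ) : Type u :=
  ∀ p : ℕ, (AlgCellComplex.criticals V p →₀ k) ≃ₗ[k] L.X p

/-- The reduction `ρ : C ⇒ L` is the W-reduction produced by the vector field `V`, where the chain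
groups of `L` are identified by `φ` with the free modules generated by the critical cells.

With respect to the decomposition (target cells) ⊕ (source cells) ⊕ (critical cells) of the chain
groups, the component `d₂₁` of the differential, from targets to sources, is an isomorphism, with
inverse `inv`, and
`d' = d₃₃ - d₃₁ d₂₁⁻¹ d₂₃`, `f = [0, -d₃₁ d₂₁⁻¹, 1]`, `g = [-d₂₁⁻¹ d₂₃, 0, 1]`, `h = d₂₁⁻¹`
(from sources to targets, and null on the other cells). -/
def IsWReduction {k : Type} [CommRing k] (C : AlgCellComplex.{u} k) (V : C.PairField)
    {L : ChainComplex (ModuleCat.{u} k) ℕ}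
    (φ : CriticalIdentification V L)
    (ρ : Reduction C.complex L) : Prop :=
  let T := AlgCellComplex.targets V
  let S := AlgCellComplex.sources V
  let K := AlgCellComplex.criticals V
  ∃ inv : ∀ p : ℕ, (S p →₀ k) →ₗ[k] (T (p + 1) →₀ k),
    (∀ p, inv p ∘ₗ C.block (T (p + 1)) (S p) = LinearMap.id) ∧
    (∀ p, C.block (T (p + 1)) (S p) ∘ₗ inv p = LinearMap.id) ∧
    (∀ p, (L.d (p + 1) p).hom ∘ₗ (φ (p + 1)).toLinearMap =
      (φ p).toLinearMap ∘ₗ (C.block (K (p + 1)) (K p) -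
        C.block (T (p + 1)) (K p) ∘ₗ inv p ∘ₗ C.block (K (p + 1)) (S p))) ∧
    (∀ p, (ρ.f.f p).hom =
      (φ p).toLinearMap ∘ₗ
        (C.proj (K p) - C.block (T (p + 1)) (K p) ∘ₗ inv p ∘ₗ C.proj (S p))) ∧
    ((ρ.g.f 0).hom ∘ₗ (φ 0).toLinearMap = C.incl (K 0)) ∧
    (∀ p, (ρ.g.f (p + 1)).hom ∘ₗ (φ (p + 1)).toLinearMap =
      C.incl (K (p + 1)) - C.incl (T (p + 1)) ∘ₗ inv p ∘ₗ C.block (K (p + 1)) (S p)) ∧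
    (∀ p, (ρ.h.hom p (p + 1)).hom = C.incl (T (p + 1)) ∘ₗ inv p ∘ₗ C.proj (S p))

/-! ### The normalized chain complex of a simplicial set -/

namespace SSet

variable (k : Type) [CommRing k] (X : SSet.{u})

/-- The coefficients `k`, in the universe of the simplicial sets under consideration. -/
noncomputable abbrev coeff : ModuleCat.{u} k := ModuleCat.of k (ULift.{u} k)

/-- The generator of the normalized chain group attached to a simplex
(it is null if this simplex is degenerate). -/
noncomputable def normGen {n : ℕ} (x : X _⦋n⦌) : (X.normalizedChainComplex (coeff.{u} k)).X n :=
  (X.ιNormalizedChainComplex (R := coeff.{u} k) x).hom (ULift.up 1)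

variable {k} in
lemma coeff_hom_ext {M : ModuleCat.{u} k} {f g : coeff.{u} k ⟶ M}
    (h : f.hom (ULift.up 1) = g.hom (ULift.up 1)) : f = g := by
  have h' : f.hom ∘ₗ (ULift.moduleEquiv (R := k) (M := k)).symm.toLinearMap =
      g.hom ∘ₗ (ULift.moduleEquiv (R := k) (M := k)).symm.toLinearMap := LinearMap.ext_ring h
  exact ModuleCat.hom_ext (LinearMap.ext fun a => LinearMap.congr_fun h' a.down)

/-- The coordinates of a normalized chain with respect to the non-degenerate simplices. -/
noncomputable def normCoord (n : ℕ) :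
    (X.normalizedChainComplex (coeff.{u} k)).X n →ₗ[k] (X.nonDegenerate n →₀ k) :=
  Finsupp.mapRange.linearMap (ULift.moduleEquiv (R := k) (M := k)).toLinearMap ∘ₗ
    (Cofan.IsColimit.desc (X.isColimitCofanNormalizedChainComplex (coeff.{u} k) n)
      (A := ModuleCat.of k (X.nonDegenerate n →₀ ULift.{u} k))
      (fun x => ModuleCat.ofHom (Finsupp.lsingle x))).hom

lemma normCoord_normGen {n : ℕ} (x : X.nonDegenerate n) :
    X.normCoord k n (X.normGen k x.1) = Finsupp.single x 1 := by
  have h := Cofan.IsColimit.fac (X.isColimitCofanNormalizedChainComplex (coeff.{u} k) n)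
    (A := ModuleCat.of k (X.nonDegenerate n →₀ ULift.{u} k))
    (fun x => ModuleCat.ofHom (Finsupp.lsingle x)) x
  have h' := congrArg (fun f => Finsupp.mapRange.linearMap
    (ULift.moduleEquiv (R := k) (M := k)).toLinearMap (f.hom (ULift.up 1))) h
  refine h'.trans ?_
  simp

/-- The basis of the normalized `n`-chains made of the non-degenerate `n`-simplices. -/
noncomputable def normBasis (n : ℕ) :
    Module.Basis (X.nonDegenerate n) k ((X.normalizedChainComplex (coeff.{u} k)).X n) :=
  Module.Basis.ofRepr <| LinearEquiv.ofLinearMap (X.normCoord k n)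
    (Finsupp.linearCombination k (fun x : X.nonDegenerate n => X.normGen k x.1))
    (by
      refine Finsupp.lhom_ext' fun x => LinearMap.ext_ring ?_
      simpa using X.normCoord_normGen k x)
    (by
      have key : ModuleCat.ofHom (Finsupp.linearCombination k
          (fun x : X.nonDegenerate n => X.normGen k x.1) ∘ₗ X.normCoord k n) = 𝟙 _ := by
        refine X.normalizedChainComplex_hom_ext (fun x hx => coeff_hom_ext ?_)
        have h2 := congrArg (Finsupp.linearCombination k
          (fun x : X.nonDegenerate n => X.normGen k x.1)) (X.normCoord_normGen k ⟨x, hx⟩)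
        rw [Finsupp.linearCombination_single, one_smul] at h2
        exact h2
      exact congrArg ModuleCat.Hom.hom key)

lemma normBasis_apply {n : ℕ} (x : X.nonDegenerate n) :
    X.normBasis k n x = X.normGen k x.1 := by
  simp [normBasis]

/-- The normalized chain complex of `X`, with the non-degenerate simplices as cells: the boundary
of a simplex is the alternating sum of its faces, where the degenerate faces are cancelled. -/
noncomputable def normalizedACC : AlgCellComplex.{u} k where
  complex := X.normalizedChainComplex (coeff.{u} k)
  cell n := X.nonDegenerate n
  basis n := X.normBasis k n

end SSet

/-! ### The tensor product of two chain complexes -/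

/-- The tensor product over `k`, as a bifunctor. -/
noncomputable def tensorBifunctor (k : Type) [CommRing k] :
    ModuleCat.{u} k ⥤ ModuleCat.{u} k ⥤ ModuleCat.{u} k where
  obj M :=
    { obj N := ModuleCat.of k (M ⊗[k] N)
      map f := ModuleCat.ofHom (LinearMap.lTensor M f.hom)
      map_id N := ModuleCat.hom_ext (LinearMap.lTensor_id M N)
      map_comp f g := ModuleCat.hom_ext (LinearMap.lTensor_comp M g.hom f.hom) }
  map f :=
    { app N := ModuleCat.ofHom (LinearMap.rTensor N f.hom)
      naturality _ _ g := ModuleCat.hom_ext <|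
        (LinearMap.rTensor_comp_lTensor _ f.hom g.hom).trans
          (LinearMap.lTensor_comp_rTensor _ f.hom g.hom).symm }
  map_id M := NatTrans.ext <| funext fun N => ModuleCat.hom_ext (LinearMap.rTensor_id N M)
  map_comp f g := NatTrans.ext <| funext fun N =>
    ModuleCat.hom_ext (LinearMap.rTensor_comp N g.hom f.hom)

section

variable {k : Type} [CommRing k]

instance : (tensorBifunctor.{u} k).PreservesZeroMorphisms where
  map_zero _ _ := NatTrans.ext <| funext fun N => ModuleCat.hom_ext (LinearMap.rTensor_zero N)

instance (M : ModuleCat.{u} k) : ((tensorBifunctor k).obj M).PreservesZeroMorphisms where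
  map_zero _ _ := ModuleCat.hom_ext (LinearMap.lTensor_zero M)

/-- The tensor product of two chain complexes: in degree `n` it is the direct sum of the
`K_p ⊗ L_q` for `p + q = n`, and `d(x ⊗ y) = dx ⊗ y + (-1)^p x ⊗ dy` for `x` of degree `p`. -/
noncomputable abbrev tensorComplex (K L : ChainComplex (ModuleCat.{u} k) ℕ) :
    ChainComplex (ModuleCat.{u} k) ℕ :=
  HomologicalComplex.mapBifunctor K L (tensorBifunctor k) (ComplexShape.down ℕ)

/-- The element `x ⊗ y` of degree `p + q` of the tensor product of two chain complexes. -/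
noncomputable def tmulComplex (K L : ChainComplex (ModuleCat.{u} k) ℕ) {p q : ℕ}
    (x : K.X p) (y : L.X q) : (tensorComplex K L).X (p + q) :=
  (HomologicalComplex.ιMapBifunctor K L (tensorBifunctor k) (ComplexShape.down ℕ)
    p q (p + q) rfl).hom (x ⊗ₜ[k] y)

end

/-! ### S-paths -/

/-- An s-path of dimension `n` in the lattice `[0..p] × [0..q]`: a sequence of `n + 1` points which
is strictly increasing for the product order. It represents a non-degenerate `n`-simplex of the
prism `Δ^p × Δ^q`. -/
structure SPath (p q n : ℕ) where
  /-- the points of the s-path -/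
  pt : Fin (n + 1) → Fin (p + 1) × Fin (q + 1)
  strictMono : StrictMono pt

namespace SPath

variable {p q n : ℕ}

/-- An s-path is interior if both its projections are surjective, that is, if the simplex which it
represents is not contained in the boundary of the prism. -/
def Interior (π : SPath p q n) : Prop :=
  (Function.Surjective fun i => (π.pt i).1) ∧ (Function.Surjective fun i => (π.pt i).2)

/-- The first projection, as a morphism of the simplex category. -/
def fst (π : SPath p q n) : ⦋n⦌ ⟶ ⦋p⦌ :=
  SimplexCategory.mkHom ⟨fun i => (π.pt i).1, fun _ _ h => (π.strictMono.monotone h).1⟩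

/-- The second projection, as a morphism of the simplex category. -/
def snd (π : SPath p q n) : ⦋n⦌ ⟶ ⦋q⦌ :=
  SimplexCategory.mkHom ⟨fun i => (π.pt i).2, fun _ _ h => (π.strictMono.monotone h).2⟩

/-- The `k`-th face of an s-path: the `k`-th point is skipped. -/
def face (π : SPath p q (n + 1)) (k : Fin (n + 2)) : SPath p q n where
  pt i := π.pt (k.succAbove i)
  strictMono := π.strictMono.comp (Fin.strictMono_succAbove k)

/-- The elementary step number `i`, from the `i`-th point to the next one, is vertical. For an
interior s-path this means that the first projection, a surjective morphism of the simplex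
category, has the degeneracy index `i`. -/
def Vertical (π : SPath p q n) (i : Fin n) : Prop :=
  (π.pt i.castSucc).1 = (π.pt i.succ).1

/-- The elementary step number `i` is horizontal. For an interior s-path this means that the
second projection has the degeneracy index `i`. -/
def Horizontal (π : SPath p q n) (i : Fin n) : Prop :=
  (π.pt i.castSucc).2 = (π.pt i.succ).2

/-- The elementary step number `i` is diagonal: the index `i` is in neither of the two lists of
the degeneracy configuration. -/
def Diagonal (π : SPath p q n) (i : Fin n) : Prop :=
  ¬ π.Vertical i ∧ ¬ π.Horizontal i

/-- The point number `k` is a right-angle bend made of a vertical step followed by a horizontal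
step; this is a `+90°` bend when the s-path is run backward. -/
def Bend (π : SPath p q n) (k : Fin (n + 1)) : Prop :=
  ∃ i j : Fin n, i.succ = k ∧ j.castSucc = k ∧ π.Vertical i ∧ π.Horizontal j

/-- When the s-path is run backward from its last point, the first event is the diagonal step
number `i`; an event is a diagonal step or a bend as above. -/
def FirstEventDiagonal (π : SPath p q n) (i : Fin n) : Prop :=
  π.Diagonal i ∧ (∀ j : Fin n, i < j → ¬ π.Diagonal j) ∧
    (∀ k : Fin (n + 1), i.castSucc < k → ¬ π.Bend k)

/-- When the s-path is run backward from its last point, the first event is the bend at the point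
number `k`. -/
def FirstEventBend (π : SPath p q n) (k : Fin (n + 1)) : Prop :=
  π.Bend k ∧ (∀ j : Fin n, k ≤ j.castSucc → ¬ π.Diagonal j) ∧
    (∀ l : Fin (n + 1), k < l → ¬ π.Bend l)

/-- Source s-paths: the first event is a diagonal step. -/
def IsSource (π : SPath p q n) : Prop := ∃ i, π.FirstEventDiagonal i

/-- Target s-paths: the first event is a bend. -/
def IsTarget (π : SPath p q n) : Prop := ∃ k, π.FirstEventBend k

/-- Critical s-paths: there is no event. -/
def IsCritical (π : SPath p q n) : Prop := (∀ i, ¬ π.Diagonal i) ∧ (∀ k, ¬ π.Bend k)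

/-- The last simplex `((0,0), (1,0), …, (p,0), (p,1), …, (p,q))` of the prism `Δ^p × Δ^q`. -/
def last (p q : ℕ) : SPath p q (p + q) where
  pt i := (⟨min i p, by omega⟩, ⟨i - p, by omega⟩)
  strictMono i j h := by
    have h' : (i : ℕ) < j := h
    rw [Prod.lt_iff]
    simp only [Fin.lt_def, Fin.le_def]
    omega

/-- The simplex of `X × Y` which is coded by an s-path `π` in the prism `σ × τ`, where `σ` is a
`p`-simplex of `X` and `τ` a `q`-simplex of `Y`. For `π` interior and `σ`, `τ` non-degenerate, this
is the canonical writing `(η^* σ, θ^* τ)` of this simplex, where the degeneracies `η` and `θ` are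
the projections of `π`: the vertical (resp. horizontal) steps are the degeneracy indices of the
first (resp. second) component. -/
def simplex {X Y : SSet.{u}} (π : SPath p q n) (σ : X _⦋p⦌) (τ : Y _⦋q⦌) :
    (X ⊗ Y : SSet.{u}) _⦋n⦌ :=
  (X.map π.fst.op σ, Y.map π.snd.op τ)

end SPath

/-! ### The Eilenberg-Zilber vector field -/

/-- The (unique) interior s-path defined by the degeneracy configuration of the simplex `ρ` of
`X × Y`, written in the canonical form, has the property `P`. -/
def HasSPath {X Y : SSet.{u}} {n : ℕ} (ρ : (X ⊗ Y : SSet.{u}) _⦋n⦌)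
    (P : ∀ {p q : ℕ}, SPath p q n → Prop) : Prop :=
  ∃ (p q : ℕ) (σ : X.nonDegenerate p) (τ : Y.nonDegenerate q) (π : SPath p q n),
    π.Interior ∧ ρ = π.simplex σ.1 τ.1 ∧ P π

/-- The Eilenberg-Zilber vector field of `X × Y`: its vectors are the pairs `(ρ, ρ')` of
non-degenerate simplices of `X × Y` such that `ρ'` is coded, in a prism `σ × τ` with `σ` and `τ`
non-degenerate, by an interior target s-path, and `ρ` is coded in the same prism by the face of
this s-path which skips the bend that is its first event. -/
def ezVectorField (X Y : SSet.{u}) : (SSet.normalizedACC ℤ (X ⊗ Y)).PairField :=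
  fun n (ρ : (X ⊗ Y : SSet.{u}).nonDegenerate n)
      (ρ' : (X ⊗ Y : SSet.{u}).nonDegenerate (n + 1)) =>
    ∃ (p q : ℕ) (σ : X.nonDegenerate p) (τ : Y.nonDegenerate q) (π : SPath p q (n + 1))
      (k : Fin (n + 2)), π.Interior ∧ π.FirstEventBend k ∧
        ρ'.1 = π.simplex σ.1 τ.1 ∧ ρ.1 = (π.face k).simplex σ.1 τ.1

/-! ### Reductions produced by vector fields -/

/-! Two arguments carry the theorem: a rank on cells, which controls the vector field, and the
Alexander-Whitney map, which gives the reduction without evaluating `d₂₁⁻¹`.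

Rank. By the Eilenberg-Zilber lemma in each component, a non-degenerate simplex of the product has a
unique code `(σ, τ, π)` (`SPathCode`). Skipping the first bend of a target s-path turns it into a
diagonal step that is again the first event, and inserting a corner in that diagonal undoes this; so
sources and targets are matched bijectively, and the paths without event remain. A source occurs
exactly once among the faces of its target, hence with incidence `±1`. Any other source face of this
target lies in a smaller prism or, in the same prism, has a smaller `SPath.weight`
(`SPath.FirstEventBend.weight_face_lt`). `SPathCode.rank` combines both quantities. A rank that
drops along `V`-paths bounds their lengths (`isAdmissible_of_rank`) and makes `d₂₁` triangular with
diagonal entries `±1`, hence invertible (`bijective_block_of_rank`).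

Reduction. Let `f` be a chain map that kills the targets and identifies the critical cells with a
basis of `L`. A source chain is the boundary of a target chain up to targets and critical cells, so
`f` is forced to be the projection of the W-reduction, and the differential of `L` is forced to be
`d'` (`exists_wReduction`). The Alexander-Whitney map is such an `f`. A bend is a degeneracy of the
first component just before a degeneracy of the second, so wherever the simplex is cut, its front
face in `X` or its back face in `Y` is degenerate. On `λ_{p,q}` only the cut at `p` survives, and it
gives `σ ⊗ τ`. Hence `d'` is the standard tensor differential. -/

namespace AlgCellComplex

variable {k : Type} [CommRing k] (C : AlgCellComplex.{u} k)

lemma proj_apply {p : ℕ} (P : Set (C.cell p)) (x : C.complex.X p) (c : P) :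
    C.proj P x c = (C.basis p).repr x c := rfl

lemma proj_incl_self {p : ℕ} (P : Set (C.cell p)) (u : P →₀ k) : C.proj P (C.incl P u) = u := by
  induction u using Finsupp.induction_linear with
  | zero => simp
  | add u v hu hv => rw [map_add, map_add, hu, hv]
  | single a r =>
    ext b
    rw [proj_apply]
    by_cases h : a = b
    · subst h
      simp [incl]
    · simp [incl, Finsupp.single_eq_of_ne' h, Finsupp.single_eq_of_ne' fun e => h (Subtype.ext e)]

lemma proj_incl_of_disjoint {p : ℕ} {P Q : Set (C.cell p)} (h : Disjoint P Q) (u : P →₀ k) :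
    C.proj Q (C.incl P u) = 0 := by
  induction u using Finsupp.induction_linear with
  | zero => simp
  | add u v hu hv => rw [map_add, map_add, hu, hv, add_zero]
  | single a r =>
    ext b
    have : a.1 ≠ b.1 := fun e => Set.disjoint_left.1 h a.2 (e ▸ b.2)
    simp [proj_apply, incl, this]

variable {C} in
lemma incl_proj_add {V : C.PairField} {p : ℕ} (h : Disjoint (sources V p) (targets V p))
    (x : C.complex.X p) :
    C.incl (targets V p) (C.proj (targets V p) x) + C.incl (sources V p) (C.proj (sources V p) x) +
      C.incl (criticals V p) (C.proj (criticals V p) x) = x := by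
  suffices C.incl (targets V p) ∘ₗ C.proj (targets V p) +
      C.incl (sources V p) ∘ₗ C.proj (sources V p) +
      C.incl (criticals V p) ∘ₗ C.proj (criticals V p) = LinearMap.id from
    LinearMap.congr_fun this x
  have self (P : Set (C.cell p)) (c : C.cell p) (hc : c ∈ P) :
      C.incl P (C.proj P (C.basis p c)) = C.basis p c := by
    have : C.basis p c = C.incl P (Finsupp.single ⟨c, hc⟩ 1) := by simp [incl]
    rw [this, proj_incl_self]
  have other (P : Set (C.cell p)) (c : C.cell p) (hc : c ∉ P) : C.proj P (C.basis p c) = 0 := by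
    ext b
    have : c ≠ b.1 := fun e => hc (e ▸ b.2)
    simp [proj_apply, this]
  refine (C.basis p).ext fun c => ?_
  simp only [LinearMap.add_apply, LinearMap.comp_apply, LinearMap.id_apply]
  by_cases hS : c ∈ sources V p
  · have hT : c ∉ targets V p := Set.disjoint_left.1 h hS
    have hK : c ∉ criticals V p := fun hc => hc (Or.inl hS)
    rw [self _ c hS, other _ c hT, other _ c hK]
    simp
  · by_cases hT : c ∈ targets V p
    · have hK : c ∉ criticals V p := fun hc => hc (Or.inr hT)
      rw [self _ c hT, other _ c hS, other _ c hK]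
      simp
    · have hK : c ∈ criticals V p := fun hc => hc.elim hS hT
      rw [self _ c hK, other _ c hS, other _ c hT]
      simp

variable {C} in
lemma d_d_apply (p : ℕ) (x : C.complex.X (p + 2)) :
    (C.complex.d (p + 1) p).hom ((C.complex.d (p + 2) (p + 1)).hom x) = 0 := by
  rw [← ModuleCat.comp_apply, C.complex.d_comp_d]
  rfl

variable {C} in
lemma f_d_apply {L : ChainComplex (ModuleCat.{u} k) ℕ} (f : C.complex ⟶ L) (p : ℕ)
    (x : C.complex.X (p + 1)) :
    (f.f p).hom ((C.complex.d (p + 1) p).hom x) = (L.d (p + 1) p).hom ((f.f (p + 1)).hom x) := by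
  rw [← ModuleCat.comp_apply, ← ModuleCat.comp_apply, f.comm]

/-- A projection `f` of a cellular complex on a chain complex which is null on the target cells of a
vector field and is the identification `φ` on its critical cells, when the component `d₂₁` of the
differential has an inverse. -/
structure CriticalProjection {C : AlgCellComplex.{u} k} (V : C.PairField)
    (L : ChainComplex (ModuleCat.{u} k) ℕ) where
  /-- the inverse of `d₂₁` -/
  inv : ∀ p : ℕ, (sources V p →₀ k) →ₗ[k] (targets V (p + 1) →₀ k)
  inv_block : ∀ p, inv p ∘ₗ C.block (targets V (p + 1)) (sources V p) = LinearMap.id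
  block_inv : ∀ p, C.block (targets V (p + 1)) (sources V p) ∘ₗ inv p = LinearMap.id
  disjoint : ∀ p, Disjoint (sources V p) (targets V p)
  /-- the identification of the critical complex -/
  φ : CriticalIdentification V L
  /-- the projection -/
  f : C.complex ⟶ L
  f_incl_targets : ∀ p (u : targets V p →₀ k), (f.f p).hom (C.incl _ u) = 0
  f_incl_criticals : ∀ p (u : criticals V p →₀ k), (f.f p).hom (C.incl _ u) = φ p u

namespace CriticalProjection

variable {C} {V : C.PairField} {L : ChainComplex (ModuleCat.{u} k) ℕ} (D : CriticalProjection V L)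

/-- The homotopy operator `d₂₁⁻¹`, as a map on all the `p`-chains. -/
noncomputable def homotopyOp (p : ℕ) : C.complex.X p →ₗ[k] C.complex.X (p + 1) :=
  C.incl (targets V (p + 1)) ∘ₗ D.inv p ∘ₗ C.proj (sources V p)

/-- The composition of the differential and of the homotopy operator. -/
noncomputable def dHomotopyOp (p : ℕ) : C.complex.X p →ₗ[k] C.complex.X p :=
  -- In degree 0 there is no differential to compose with, and `hd` is null there.
  match p with
  | 0 => 0
  | p + 1 => D.homotopyOp p ∘ₗ (C.complex.d (p + 1) p).hom

/-- The homotopy operator, in the form which is needed for homotopies. -/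
noncomputable def homotopyHom (i j : ℕ) : C.complex.X i ⟶ C.complex.X j :=
  if h : i + 1 = j then
    ModuleCat.ofHom (D.homotopyOp i) ≫ eqToHom (congrArg C.complex.X h) else 0

lemma homotopyHom_succ (i : ℕ) :
    D.homotopyHom i (i + 1) = ModuleCat.ofHom (D.homotopyOp i) := by
  simp [homotopyHom]

lemma homotopyHom_eq_zero {i j : ℕ} (h : i + 1 ≠ j) : D.homotopyHom i j = 0 := dif_neg h

lemma homotopyOp_incl_targets (p : ℕ) (u : targets V p →₀ k) :
    D.homotopyOp p (C.incl _ u) = 0 := by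
  simp [homotopyOp, C.proj_incl_of_disjoint (D.disjoint p).symm]

lemma homotopyOp_incl_criticals (p : ℕ) (u : criticals V p →₀ k) :
    D.homotopyOp p (C.incl _ u) = 0 := by
  have : Disjoint (criticals V p) (sources V p) :=
    Set.disjoint_left.2 fun _ hc hs => hc (Or.inl hs)
  simp [homotopyOp, C.proj_incl_of_disjoint this]

lemma homotopyOp_homotopyOp (p : ℕ) (x : C.complex.X p) :
    D.homotopyOp (p + 1) (D.homotopyOp p x) = 0 :=
  D.homotopyOp_incl_targets _ _

lemma dHomotopyOp_d (p : ℕ) (x : C.complex.X (p + 1)) :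
    D.dHomotopyOp p ((C.complex.d (p + 1) p).hom x) = 0 := by
  cases p with
  | zero => rfl
  | succ p => simp [dHomotopyOp, d_d_apply]

lemma dHomotopyOp_mem (p : ℕ) (x : C.complex.X p) :
    ∃ u, D.dHomotopyOp p x = C.incl (targets V p) u := by
  cases p with
  | zero => exact ⟨0, by simp [dHomotopyOp]⟩
  | succ p => exact ⟨_, rfl⟩

/-- This is `d₂₁⁻¹ d₂₁ = 1`; in degree 0 there are no target cells. -/
lemma dHomotopyOp_incl_targets (p : ℕ) (u : targets V p →₀ k) :
    D.dHomotopyOp p (C.incl _ u) = C.incl _ u := by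
  cases p with
  | zero =>
    have : u = 0 := Finsupp.ext fun a => a.2.elim
    simp [this]
  | succ p => exact congrArg (C.incl _) (LinearMap.congr_fun (D.inv_block p) u)

/-- The target chain `d₂₁⁻¹ u` has a boundary whose source component is `u`. Linear identities
therefore need checking only on targets, critical cells and boundaries of targets. -/
lemma incl_sources_eq (p : ℕ) (u : sources V p →₀ k) :
    C.incl _ u = (C.complex.d (p + 1) p).hom (C.incl _ (D.inv p u)) -
      C.incl (targets V p) (C.proj _ ((C.complex.d (p + 1) p).hom (C.incl _ (D.inv p u)))) -
      C.incl (criticals V p) (C.block _ _ (D.inv p u)) := by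
  have h := incl_proj_add (D.disjoint p) ((C.complex.d (p + 1) p).hom (C.incl _ (D.inv p u)))
  have h' : C.proj (sources V p) ((C.complex.d (p + 1) p).hom (C.incl _ (D.inv p u))) = u :=
    LinearMap.congr_fun (D.block_inv p) u
  rw [h'] at h
  simp only [block, LinearMap.comp_apply]
  rw [eq_sub_iff_add_eq, eq_sub_iff_add_eq]
  exact (by abel : _ = _).trans h

/-- A chain map null on targets is null on their boundaries too, so the decomposition of source
chains leaves only critical terms. -/
lemma f_apply_eq (p : ℕ) (x : C.complex.X p) :
    (D.f.f p).hom x = D.φ p (C.proj _ x - C.block _ _ (D.inv p (C.proj _ x))) := by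
  conv_lhs => rw [← incl_proj_add (D.disjoint p) x, D.incl_sources_eq]
  simp only [map_add, map_sub, D.f_incl_targets, D.f_incl_criticals, f_d_apply D.f]
  simp [sub_eq_add_neg, add_comm]

/-- The injection of the W-reduction. -/
noncomputable def injOp (p : ℕ) : L.X p →ₗ[k] C.complex.X p :=
  (C.incl _ - D.dHomotopyOp p ∘ₗ C.incl _) ∘ₗ (D.φ p).symm.toLinearMap

lemma f_injOp (p : ℕ) (y : L.X p) : (D.f.f p).hom (D.injOp p y) = y := by
  obtain ⟨u, hu⟩ := D.dHomotopyOp_mem p (C.incl (criticals V p) ((D.φ p).symm y))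
  simp [injOp, hu, D.f_incl_targets, D.f_incl_criticals]

/-- This is `gf = 1 - dh - hd`, checked on the three generating families. On the boundary `dt` of a
target chain, `f` vanishes, `h(dt) = t` and `hd(dt) = 0`. -/
lemma injOp_f (p : ℕ) (x : C.complex.X p) :
    D.injOp p ((D.f.f p).hom x) =
      x - (C.complex.d (p + 1) p).hom (D.homotopyOp p x) - D.dHomotopyOp p x := by
  have hT (u) : D.injOp p ((D.f.f p).hom (C.incl (targets V p) u)) =
      C.incl _ u - (C.complex.d (p + 1) p).hom (D.homotopyOp p (C.incl _ u)) -
        D.dHomotopyOp p (C.incl _ u) := by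
    rw [D.f_incl_targets, D.homotopyOp_incl_targets, D.dHomotopyOp_incl_targets]
    simp
  have hK (u) : D.injOp p ((D.f.f p).hom (C.incl (criticals V p) u)) =
      C.incl _ u - (C.complex.d (p + 1) p).hom (D.homotopyOp p (C.incl _ u)) -
        D.dHomotopyOp p (C.incl _ u) := by
    rw [D.f_incl_criticals, D.homotopyOp_incl_criticals]
    simp [injOp]
  have hd (u) : D.injOp p ((D.f.f p).hom ((C.complex.d (p + 1) p).hom
      (C.incl (targets V (p + 1)) u))) =
      (C.complex.d (p + 1) p).hom (C.incl (targets V (p + 1)) u) -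
        (C.complex.d (p + 1) p).hom (D.homotopyOp p
          ((C.complex.d (p + 1) p).hom (C.incl (targets V (p + 1)) u))) -
        D.dHomotopyOp p ((C.complex.d (p + 1) p).hom (C.incl (targets V (p + 1)) u)) := by
    have h : D.homotopyOp p ((C.complex.d (p + 1) p).hom (C.incl (targets V (p + 1)) u)) =
      C.incl (targets V (p + 1)) u := D.dHomotopyOp_incl_targets (p + 1) u
    rw [f_d_apply D.f, D.f_incl_targets, h, D.dHomotopyOp_d]
    simp
  rw [← incl_proj_add (D.disjoint p) x, D.incl_sources_eq]
  simp only [map_add, map_sub, hT, hK, hd]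
  abel

/-- The homotopy formula at `x = gy`, followed by `d`, and the same formula at `dx` both end in `dx
- dhdx`, because `fg = 1` and `dd = 0`. -/
lemma d_injOp (p : ℕ) (y : L.X (p + 1)) :
    (C.complex.d (p + 1) p).hom (D.injOp (p + 1) y) =
      D.injOp p ((L.d (p + 1) p).hom y) := by
  have h1 := D.f_injOp (p + 1) y
  have h2 := D.injOp_f (p + 1) (D.injOp (p + 1) y)
  have h3 := D.injOp_f p
    ((C.complex.d (p + 1) p).hom (D.injOp (p + 1) y))
  rw [f_d_apply D.f, h1, D.dHomotopyOp_d] at h3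
  rw [h1] at h2
  rw [h3]
  conv_lhs => rw [h2]
  simp [dHomotopyOp, d_d_apply]

/-- The W-reduction, when the projection `f` is already known. -/
noncomputable def wReduction : Reduction C.complex L where
  f := D.f
  g :=
    { f p := ModuleCat.ofHom (D.injOp p)
      comm' := by
        rintro _ p rfl
        ext y
        exact D.d_injOp p y }
  h :=
    { hom := D.homotopyHom
      zero i j h := D.homotopyHom_eq_zero fun e => h e
      comm p := by
        ext x
        have h := D.injOp_f p x
        have e1 : prevD p D.homotopyHom =
            ModuleCat.ofHom (D.homotopyOp p) ≫ C.complex.d (p + 1) p := by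
          rw [prevD_eq _ (show (ComplexShape.down ℕ).Rel (p + 1) p from rfl), D.homotopyHom_succ]
        have e2 : dNext p D.homotopyHom = ModuleCat.ofHom (D.dHomotopyOp p) := by
          cases p with
          | zero =>
            rw [dNext_eq_zero _ _ (by simp)]
            rfl
          | succ p =>
            rw [dNext_eq _ (show (ComplexShape.down ℕ).Rel (p + 1) p from rfl), D.homotopyHom_succ]
            rfl
        rw [e1, e2]
        change x = D.dHomotopyOp p x + (C.complex.d (p + 1) p).hom (D.homotopyOp p x) +
          D.injOp p ((D.f.f p).hom x)
        rw [h]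
        abel }
  g_comp_f := by
    ext p y
    exact D.f_injOp p y
  h_comp_f i j := by
    change D.homotopyHom i j ≫ D.f.f j = 0
    by_cases h : i + 1 = j
    · subst h
      rw [D.homotopyHom_succ]
      ext x
      exact D.f_incl_targets _ _
    · rw [D.homotopyHom_eq_zero h, zero_comp]
  g_comp_h i j := by
    change ModuleCat.ofHom (D.injOp i) ≫ D.homotopyHom i j = 0
    by_cases h : i + 1 = j
    · subst h
      rw [D.homotopyHom_succ]
      ext y
      change D.homotopyOp i (D.injOp i y) = 0
      obtain ⟨u, hu⟩ := D.dHomotopyOp_mem i (C.incl (criticals V i) ((D.φ i).symm y))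
      simp [injOp, hu, D.homotopyOp_incl_targets, D.homotopyOp_incl_criticals]
    · rw [D.homotopyHom_eq_zero h, comp_zero]
  h_comp_h i j l := by
    change D.homotopyHom i j ≫ D.homotopyHom j l = 0
    by_cases h : i + 1 = j
    · by_cases h' : j + 1 = l
      · subst h h'
        rw [D.homotopyHom_succ, D.homotopyHom_succ]
        ext x
        exact D.homotopyOp_homotopyOp i x
      · rw [D.homotopyHom_eq_zero h', comp_zero]
    · rw [D.homotopyHom_eq_zero h, zero_comp]

lemma isWReduction_wReduction :
    IsWReduction C V D.φ D.wReduction := by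
  refine ⟨D.inv, D.inv_block, D.block_inv, fun p => ?_, fun p => ?_, ?_, fun p => ?_, fun p => ?_⟩
  · refine LinearMap.ext fun v => ?_
    change (L.d (p + 1) p).hom (D.φ (p + 1) v) = _
    -- The formula for `d'` is the formula for `f` evaluated on the boundary of a critical chain.
    rw [← D.f_incl_criticals, ← f_d_apply D.f, D.f_apply_eq]
    rfl
  · ext x
    exact D.f_apply_eq p x
  · refine LinearMap.ext fun u => ?_
    change D.injOp 0 (D.φ 0 u) = _
    simp [injOp, dHomotopyOp]
  · refine LinearMap.ext fun u => ?_
    change D.injOp (p + 1) (D.φ (p + 1) u) = _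
    simp [injOp, dHomotopyOp, homotopyOp, block]
  · change (D.homotopyHom p (p + 1)).hom = _
    rw [D.homotopyHom_succ]
    rfl

end CriticalProjection

variable {C} in
-- The differential of `L` does not have to be compared with `d'` by summing over zigzags: a chain
-- map with the prescribed values on targets and critical cells already determines it.
theorem exists_wReduction {V : C.PairField} {L : ChainComplex (ModuleCat.{u} k) ℕ}
    (hdisj : ∀ p, Disjoint (sources V p) (targets V p))
    (hbij : ∀ p, Function.Bijective (C.block (targets V (p + 1)) (sources V p)))
    (φ : CriticalIdentification V L) (f : C.complex ⟶ L)
    (hfT : ∀ p, ∀ t ∈ targets V p, (f.f p).hom (C.basis p t) = 0)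
    (hfK : ∀ p (c : criticals V p), (f.f p).hom (C.basis p c) = φ p (Finsupp.single c 1)) :
    ∃ ρ : Reduction C.complex L, IsWReduction C V φ ρ := by
  let e p := LinearEquiv.ofBijective _ (hbij p)
  refine ⟨_, CriticalProjection.isWReduction_wReduction
    { inv p := (e p).symm.toLinearMap
      inv_block p := LinearMap.ext fun u => (e p).symm_apply_apply u
      block_inv p := LinearMap.ext fun u => (e p).apply_symm_apply u
      disjoint := hdisj
      φ := φ
      f := f
      f_incl_targets p u := ?_
      f_incl_criticals p u := ?_ }⟩
  · suffices (f.f p).hom ∘ₗ C.incl (targets V p) = 0 from LinearMap.congr_fun this u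
    refine Finsupp.lhom_ext' fun t => LinearMap.ext_ring ?_
    simpa [incl] using hfT p t.1 t.2
  · suffices (f.f p).hom ∘ₗ C.incl (criticals V p) = (φ p).toLinearMap from
      LinearMap.congr_fun this u
    refine Finsupp.lhom_ext' fun t => LinearMap.ext_ring ?_
    simpa [incl] using hfK p t

/-! ### Ranked vector fields -/

variable {C} in
/-- A ranked vector field is admissible. -/
lemma isAdmissible_of_rank {V : C.PairField} (rank : ∀ p, C.cell p → ℕ)
    (h : ∀ p (σ σ' : C.cell p) (τ : C.cell (p + 1)), V p σ τ → σ' ∈ sources V p → C.IsFace σ' τ →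
      σ' ≠ σ → rank p σ' < rank p σ) : IsAdmissible V := by
  refine fun p => ⟨fun σ => rank p σ + 1, fun v π => ?_⟩
  induction π generalizing v with
  | nil => intro _; simp
  | cons w π ih =>
    rintro ⟨hV, hc⟩
    rw [List.isChain_cons_cons] at hc
    have h1 := ih w ⟨fun x hx => hV x (List.mem_cons_of_mem _ hx), hc.2⟩
    have h2 := h p v.1 w.1 v.2 (hV v (by simp)) ⟨_, hV w (by simp)⟩ hc.1.1 hc.1.2
    rw [List.length_cons]
    dsimp only at h1 ⊢
    omega

variable {C} in
/-- The component `d₂₁` of the differential of a ranked vector field is bijective. -/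
lemma bijective_block_of_rank {V : C.PairField} (hV : IsDiscreteVectorField V)
    (rank : ∀ p, C.cell p → ℕ)
    (h : ∀ p (σ σ' : C.cell p) (τ : C.cell (p + 1)), V p σ τ → σ' ∈ sources V p → C.IsFace σ' τ →
      σ' ≠ σ → rank p σ' < rank p σ) (p : ℕ) :
    Function.Bijective (C.block (targets V (p + 1)) (sources V p)) := by
  have block_single (t : targets V (p + 1)) (s : sources V p) :
      C.block _ (sources V p) (Finsupp.single t 1) s = C.incidence s.1 t.1 := by
    simp [block, incl, proj_apply, incidence]
  have unit {s : C.cell p} {t : C.cell (p + 1)} (hst : V p s t) :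
      C.incidence s t * C.incidence s t = 1 := by
    rcases hV.regular p s t hst with e | e <;> simp [e]
  constructor
  · rw [injective_iff_map_eq_zero]
    intro u hu
    by_contra hne
    choose src hsrc using fun t : targets V (p + 1) => t.2
    -- At the source of a `t` of maximal rank in the support, no other target of the support
    -- contributes: its own source would have a strictly larger rank.
    obtain ⟨t, ht, hmax⟩ := Finset.exists_max_image u.support (fun t => rank p (src t))
      (Finsupp.support_nonempty_iff.2 hne)
    have h0 : C.block _ (sources V p) u ⟨src t, _, hsrc t⟩ = 0 := by rw [hu]; rfl
    have h1 : C.block _ (sources V p) u ⟨src t, _, hsrc t⟩ =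
        u.sum fun t' r => r * C.incidence (src t) t'.1 := by
      conv_lhs => rw [← Finsupp.sum_single u, Finsupp.sum, map_sum, Finsupp.finsetSum_apply]
      refine Finset.sum_congr rfl fun t' _ => ?_
      rw [← mul_one (u t'), ← smul_eq_mul, ← Finsupp.smul_single, map_smul, Finsupp.smul_apply,
        block_single]
      simp
    rw [h1, Finsupp.sum, Finset.sum_eq_single t] at h0
    · have := unit (hsrc t)
      apply Finsupp.mem_support_iff.1 ht
      linear_combination C.incidence (src t) t.1 * h0 - u t * this
    · intro t' ht' hne
      by_cases hf : C.incidence (src t) t'.1 = 0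
      · rw [hf, mul_zero]
      · refine absurd (h p (src t') (src t) t'.1 (hsrc t') ⟨_, hsrc t⟩ hf fun e => hne ?_)
          (not_lt.2 (hmax t' ht'))
        exact Subtype.ext (hV.target_unique p _ _ _ (hsrc t') (e ▸ hsrc t))
    · exact fun hn => absurd ht hn
  · have comb (u : sources V p →₀ k) (hu : ∀ s ∈ u.support,
        Finsupp.single s 1 ∈ LinearMap.range (C.block (targets V (p + 1)) (sources V p))) :
        u ∈ LinearMap.range (C.block (targets V (p + 1)) (sources V p)) := by
      rw [← Finsupp.sum_single u]
      refine Submodule.sum_mem _ fun s hs => ?_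
      have e : Finsupp.single s (u s) = u s • Finsupp.single s 1 := by simp
      rw [e]
      exact Submodule.smul_mem _ _ (hu s hs)
    -- Induction on the rank: the image of the target paired with `s` is `±s` plus source cells of
    -- smaller rank.
    have key (r : ℕ) (s : sources V p) (hr : rank p s.1 = r) :
        Finsupp.single s 1 ∈ LinearMap.range (C.block (targets V (p + 1)) (sources V p)) := by
      induction r using Nat.strong_induction_on generalizing s with
      | _ r ih =>
        obtain ⟨s, t, hst⟩ := s
        let t' : targets V (p + 1) := ⟨t, s, hst⟩
        let s' : sources V p := ⟨s, t, hst⟩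
        have rest : C.block _ (sources V p) (Finsupp.single t' 1) -
            C.incidence s t • Finsupp.single s' 1 ∈
            LinearMap.range (C.block (targets V (p + 1)) (sources V p)) := by
          refine comb _ fun a ha => ?_
          have ha' := Finsupp.mem_support_iff.1 ha
          rw [Finsupp.sub_apply, block_single, Finsupp.smul_apply] at ha'
          by_cases e : a = s'
          · subst e
            simp [s', t'] at ha'
          · rw [Finsupp.single_eq_of_ne e, smul_zero, sub_zero] at ha'
            exact ih _ (hr ▸ h p s a.1 t hst a.2 ha' fun e' => e (Subtype.ext e')) a rfl
        have hsum := Submodule.smul_mem _ (C.incidence s t)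
          (Submodule.sub_mem _ (LinearMap.mem_range_self _ (Finsupp.single t' 1)) rest)
        rwa [sub_sub_cancel, smul_smul, unit hst, one_smul] at hsum
    rw [← LinearMap.range_eq_top, eq_top_iff]
    exact fun u _ => comb u fun s _ => key _ s rfl

end AlgCellComplex

/-! ### Combinatorics of s-paths -/

namespace SPath

variable {p q n : ℕ}

/-- The first coordinate of the point number `i`, as a function on the natural numbers. -/
def xc (π : SPath p q n) (i : ℕ) : ℕ := (π.pt ⟨min i n, by omega⟩).1

/-- The second coordinate of the point number `i`, as a function on the natural numbers. -/
def yc (π : SPath p q n) (i : ℕ) : ℕ := (π.pt ⟨min i n, by omega⟩).2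

lemma pt_fst (π : SPath p q n) (i : Fin (n + 1)) : ((π.pt i).1 : ℕ) = π.xc i := by
  have : (⟨min i n, by omega⟩ : Fin (n + 1)) = i := Fin.ext (by simp; omega)
  rw [xc, this]

lemma pt_snd (π : SPath p q n) (i : Fin (n + 1)) : ((π.pt i).2 : ℕ) = π.yc i := by
  have : (⟨min i n, by omega⟩ : Fin (n + 1)) = i := Fin.ext (by simp; omega)
  rw [yc, this]

lemma ext_coord {π π' : SPath p q n} (hx : ∀ i ≤ n, π.xc i = π'.xc i)
    (hy : ∀ i ≤ n, π.yc i = π'.yc i) : π = π' := by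
  obtain ⟨f, hf⟩ := π
  obtain ⟨f', hf'⟩ := π'
  congr
  funext i
  refine Prod.ext (Fin.ext ?_) (Fin.ext ?_)
  · have := hx i (by omega)
    rwa [← pt_fst, ← pt_fst] at this
  · have := hy i (by omega)
    rwa [← pt_snd, ← pt_snd] at this

lemma xc_le (π : SPath p q n) (i : ℕ) : π.xc i ≤ p := by
  have := (π.pt ⟨min i n, by omega⟩).1.2
  rw [xc]
  omega

lemma yc_le (π : SPath p q n) (i : ℕ) : π.yc i ≤ q := by
  have := (π.pt ⟨min i n, by omega⟩).2.2
  rw [yc]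
  omega

/-- No bound on the indices is needed, since the clamp `min i n` makes the coordinate constant
beyond `n`. -/
lemma xc_mono (π : SPath p q n) {i j : ℕ} (h : i ≤ j) : π.xc i ≤ π.xc j :=
  (π.strictMono.monotone (a := ⟨min i n, by omega⟩) (b := ⟨min j n, by omega⟩)
    (Fin.mk_le_mk.2 (by omega))).1

lemma yc_mono (π : SPath p q n) {i j : ℕ} (h : i ≤ j) : π.yc i ≤ π.yc j :=
  (π.strictMono.monotone (a := ⟨min i n, by omega⟩) (b := ⟨min j n, by omega⟩)
    (Fin.mk_le_mk.2 (by omega))).2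

lemma step_lt (π : SPath p q n) {i : ℕ} (h : i < n) :
    π.xc i + π.yc i < π.xc (i + 1) + π.yc (i + 1) := by
  have h1 := π.strictMono (a := ⟨min i n, by omega⟩) (b := ⟨min (i + 1) n, by omega⟩)
    (Fin.mk_lt_mk.2 (by omega))
  rw [Prod.lt_iff] at h1
  simp only [Fin.lt_def, Fin.le_def] at h1
  simp only [xc, yc]
  omega

/-- The s-path with given coordinates. -/
def ofCoord (x y : ℕ → ℕ) (hx : ∀ i ≤ n, x i ≤ p) (hy : ∀ i ≤ n, y i ≤ q)
    (h : ∀ i < n, x i ≤ x (i + 1) ∧ y i ≤ y (i + 1) ∧ x i + y i < x (i + 1) + y (i + 1)) :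
    SPath p q n where
  pt i := (⟨x i, by have := hx i (by omega); omega⟩, ⟨y i, by have := hy i (by omega); omega⟩)
  strictMono := by
    rw [Fin.strictMono_iff_lt_succ]
    intro i
    have := h i i.2
    rw [Prod.lt_iff]
    simp only [Fin.lt_def, Fin.le_def, Fin.val_castSucc, Fin.val_succ]
    omega

lemma xc_ofCoord {x y : ℕ → ℕ} {hx : ∀ i ≤ n, x i ≤ p} {hy : ∀ i ≤ n, y i ≤ q}
    {h : ∀ i < n, x i ≤ x (i + 1) ∧ y i ≤ y (i + 1) ∧ x i + y i < x (i + 1) + y (i + 1)}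
    {i : ℕ} (hi : i ≤ n) : (ofCoord x y hx hy h).xc i = x i := by
  simp [xc, ofCoord, hi]

lemma yc_ofCoord {x y : ℕ → ℕ} {hx : ∀ i ≤ n, x i ≤ p} {hy : ∀ i ≤ n, y i ≤ q}
    {h : ∀ i < n, x i ≤ x (i + 1) ∧ y i ≤ y (i + 1) ∧ x i + y i < x (i + 1) + y (i + 1)}
    {i : ℕ} (hi : i ≤ n) : (ofCoord x y hx hy h).yc i = y i := by
  simp [yc, ofCoord, hi]

lemma xc_face (π : SPath p q (n + 1)) (k : Fin (n + 2)) {i : ℕ} (hi : i ≤ n) :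
    (π.face k).xc i = if i < k then π.xc i else π.xc (i + 1) := by
  have h := (π.face k).pt_fst ⟨i, by omega⟩
  rw [← h]
  simp only [face, pt_fst, Fin.succAbove, Fin.lt_def, Fin.val_castSucc]
  split_ifs <;> rfl

lemma yc_face (π : SPath p q (n + 1)) (k : Fin (n + 2)) {i : ℕ} (hi : i ≤ n) :
    (π.face k).yc i = if i < k then π.yc i else π.yc (i + 1) := by
  have h := (π.face k).pt_snd ⟨i, by omega⟩
  rw [← h]
  simp only [face, pt_snd, Fin.succAbove, Fin.lt_def, Fin.val_castSucc]
  split_ifs <;> rfl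

/-- A discrete intermediate value property. It turns interiority into endpoint conditions and step
inequalities, which linear arithmetic can use. -/
lemma surjective_iff_step {N P : ℕ} {f : Fin (N + 1) → Fin (P + 1)} {x : ℕ → ℕ}
    (hf : ∀ i, (f i : ℕ) = x i) (hx : Monotone x) :
    Function.Surjective f ↔ x 0 = 0 ∧ x N = P ∧ ∀ i < N, x (i + 1) ≤ x i + 1 := by
  constructor
  · intro h
    have val (v : ℕ) (hv : v ≤ P) : ∃ i ≤ N, x i = v := by
      obtain ⟨i, hi⟩ := h ⟨v, by omega⟩
      exact ⟨i, by omega, by rw [← hf, hi]⟩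
    refine ⟨?_, ?_, fun i hi => ?_⟩
    · obtain ⟨i, -, h0⟩ := val 0 (Nat.zero_le _)
      have := hx (Nat.zero_le i)
      omega
    · obtain ⟨i, hi, h0⟩ := val P le_rfl
      have := hx hi
      have := (f (Fin.last N)).2
      rw [hf, Fin.val_last] at this
      omega
    · by_contra! hlt
      have := (f ⟨i + 1, by omega⟩).2
      rw [hf] at this
      obtain ⟨j, -, hj⟩ := val (x i + 1) (by dsimp only at this; omega)
      rcases Nat.lt_or_ge i j with hij | hij
      · have := hx (show i + 1 ≤ j from hij)
        omega
      · have := hx hij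
        omega
  · rintro ⟨h0, hN, hs⟩ v
    have key : ∀ i ≤ N, ∀ w ≤ x i, ∃ j ≤ N, x j = w := by
      intro i
      induction i with
      | zero => exact fun _ w hw => ⟨0, by omega, by omega⟩
      | succ i ih =>
        intro hi w hw
        have := hs i hi
        rcases Nat.lt_or_ge (x i) w with hlt | hge
        · exact ⟨i + 1, hi, by omega⟩
        · exact ih (by omega) w hge
    obtain ⟨j, hj, e⟩ := key N le_rfl v (by omega)
    exact ⟨⟨j, by omega⟩, Fin.ext (by rw [hf]; exact e)⟩

lemma interior_iff (π : SPath p q n) : π.Interior ↔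
    (π.xc 0 = 0 ∧ π.xc n = p ∧ ∀ i < n, π.xc (i + 1) ≤ π.xc i + 1) ∧
      (π.yc 0 = 0 ∧ π.yc n = q ∧ ∀ i < n, π.yc (i + 1) ≤ π.yc i + 1) :=
  and_congr (surjective_iff_step π.pt_fst fun _ _ => π.xc_mono)
    (surjective_iff_step π.pt_snd fun _ _ => π.yc_mono)

lemma vertical_iff (π : SPath p q n) (i : Fin n) : π.Vertical i ↔ π.xc i = π.xc (i + 1) := by
  rw [Vertical, Fin.ext_iff, pt_fst, pt_fst]
  rfl

lemma horizontal_iff (π : SPath p q n) (i : Fin n) : π.Horizontal i ↔ π.yc i = π.yc (i + 1) := by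
  rw [Horizontal, Fin.ext_iff, pt_snd, pt_snd]
  rfl

/-- There is a bend at the point number `k`, a natural number. -/
def BendAt (π : SPath p q n) (k : ℕ) : Prop :=
  0 < k ∧ k < n ∧ π.xc (k - 1) = π.xc k ∧ π.yc k = π.yc (k + 1)

/-- The step number `i`, a natural number, is diagonal. -/
def DiagonalAt (π : SPath p q n) (i : ℕ) : Prop :=
  π.xc i ≠ π.xc (i + 1) ∧ π.yc i ≠ π.yc (i + 1)

lemma bend_iff (π : SPath p q n) (k : Fin (n + 1)) : π.Bend k ↔ π.BendAt k := by
  constructor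
  · rintro ⟨i, j, hi, hj, hv, hh⟩
    rw [vertical_iff] at hv
    rw [horizontal_iff] at hh
    rw [Fin.ext_iff, Fin.val_succ] at hi
    rw [Fin.ext_iff, Fin.val_castSucc] at hj
    refine ⟨by omega, by omega, ?_, ?_⟩
    · rw [← hi, Nat.add_sub_cancel, hv]
    · rw [← hj, hh]
  · rintro ⟨h0, hn, hv, hh⟩
    refine ⟨⟨k - 1, by omega⟩, ⟨k, hn⟩, Fin.ext ?_, rfl, ?_, ?_⟩
    · simp only [Fin.val_succ]
      omega
    · rw [vertical_iff]
      simp only [Nat.sub_add_cancel (show 1 ≤ (k : ℕ) from h0), hv]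
    · rw [horizontal_iff]
      exact hh

lemma diagonal_iff (π : SPath p q n) (i : Fin n) : π.Diagonal i ↔ π.DiagonalAt i := by
  rw [Diagonal, vertical_iff, horizontal_iff, DiagonalAt]

lemma firstEventDiagonal_iff (π : SPath p q n) (i : Fin n) : π.FirstEventDiagonal i ↔
    π.DiagonalAt i ∧ (∀ j : ℕ, i < j → j < n → ¬ π.DiagonalAt j) ∧
      ∀ k : ℕ, i < k → ¬ π.BendAt k := by
  rw [FirstEventDiagonal, diagonal_iff]
  refine and_congr Iff.rfl (and_congr ⟨fun h j hij hj hd => ?_, fun h j hij hd => ?_⟩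
    ⟨fun h k hik hb => ?_, fun h k hik hb => ?_⟩)
  · exact h ⟨j, hj⟩ hij ((diagonal_iff _ _).2 hd)
  · exact h j hij j.2 ((diagonal_iff _ _).1 hd)
  · exact h ⟨k, hb.2.1.trans n.lt_succ_self⟩ hik ((bend_iff _ _).2 hb)
  · exact h k hik ((bend_iff _ _).1 hb)

lemma firstEventBend_iff (π : SPath p q n) (k : Fin (n + 1)) : π.FirstEventBend k ↔
    π.BendAt k ∧ (∀ j : ℕ, k ≤ j → j < n → ¬ π.DiagonalAt j) ∧
      ∀ l : ℕ, k < l → ¬ π.BendAt l := by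
  rw [FirstEventBend, bend_iff]
  refine and_congr Iff.rfl (and_congr ⟨fun h j hij hj hd => ?_, fun h j hij hd => ?_⟩
    ⟨fun h l hkl hb => ?_, fun h l hkl hb => ?_⟩)
  · exact h ⟨j, hj⟩ hij ((diagonal_iff _ _).2 hd)
  · exact h j hij j.2 ((diagonal_iff _ _).1 hd)
  · exact h ⟨l, hb.2.1.trans n.lt_succ_self⟩ hkl ((bend_iff _ _).2 hb)
  · exact h l hkl ((bend_iff _ _).1 hb)

lemma isCritical_iff (π : SPath p q n) : π.IsCritical ↔
    (∀ i < n, ¬ π.DiagonalAt i) ∧ ∀ k, ¬ π.BendAt k := by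
  refine and_congr ⟨fun h i hi hd => ?_, fun h i hd => ?_⟩ ⟨fun h k hb => ?_, fun h k hb => ?_⟩
  · exact h ⟨i, hi⟩ ((diagonal_iff _ _).2 hd)
  · exact h i i.2 ((diagonal_iff _ _).1 hd)
  · exact h ⟨k, hb.2.1.trans n.lt_succ_self⟩ ((bend_iff _ _).2 hb)
  · exact h k ((bend_iff _ _).1 hb)

/-! ### The trichotomy source, target, critical, and the matching of sources with targets -/

lemma not_isSource_and_isTarget (π : SPath p q n) : ¬ (π.IsSource ∧ π.IsTarget) := by
  rintro ⟨⟨i, hi⟩, ⟨k, hk⟩⟩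
  rcases le_or_gt k i.castSucc with h | h
  · exact hk.2.1 i h hi.1
  · exact hi.2.2 k h hk.1

/-- Scan backward, with no event met after the point `n - m`. At each stage the bend at `n - m` is
tested before the diagonal step `n - (m + 1)`, which ends at that point. -/
lemma isSource_or_isTarget_or_isCritical (π : SPath p q n) :
    π.IsSource ∨ π.IsTarget ∨ π.IsCritical := by
  have key : ∀ m, m ≤ n → (π.IsSource ∨ π.IsTarget) ∨
      ((∀ j, n - m ≤ j → j < n → ¬ π.DiagonalAt j) ∧ ∀ k, n - m < k → ¬ π.BendAt k) := by
    intro m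
    induction m with
    | zero => exact fun _ => Or.inr ⟨fun j hj hj' => by omega, fun k hk hb => by
        have := hb.2.1; omega⟩
    | succ m ih =>
      intro hm
      rcases ih (by omega) with h | ⟨hd, hb⟩
      · exact Or.inl h
      · by_cases h1 : π.BendAt (n - m)
        · refine Or.inl (Or.inr ⟨⟨n - m, by omega⟩, ?_⟩)
          rw [firstEventBend_iff]
          exact ⟨h1, hd, hb⟩
        · have hb' : ∀ k, n - (m + 1) < k → ¬ π.BendAt k := by
            intro k hk
            rcases eq_or_lt_of_le (show n - m ≤ k by omega) with rfl | hlt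
            · exact h1
            · exact hb k hlt
          by_cases h2 : π.DiagonalAt (n - (m + 1))
          · refine Or.inl (Or.inl ⟨⟨n - (m + 1), by omega⟩, ?_⟩)
            rw [firstEventDiagonal_iff]
            exact ⟨h2, fun j hj hj' => hd j (by dsimp only at hj; omega) hj', hb'⟩
          · refine Or.inr ⟨fun j hj hj' => ?_, hb'⟩
            rcases eq_or_lt_of_le hj with rfl | hlt
            · exact h2
            · exact hd j (by omega) hj'
  rcases key n le_rfl with (h | h) | ⟨hd, hb⟩
  · exact Or.inl h
  · exact Or.inr (Or.inl h)
  · refine Or.inr (Or.inr ((isCritical_iff _).2 ⟨fun i hi => hd i (by omega) hi, fun k hk => ?_⟩))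
    exact hb k (by have := hk.1; omega) hk

lemma not_isSource_and_isCritical (π : SPath p q n) : ¬ (π.IsSource ∧ π.IsCritical) := by
  rintro ⟨⟨i, hi⟩, hc⟩
  exact hc.1 i hi.1

lemma not_isTarget_and_isCritical (π : SPath p q n) : ¬ (π.IsTarget ∧ π.IsCritical) := by
  rintro ⟨⟨k, hk⟩, hc⟩
  exact hc.2 k hk.1

lemma FirstEventBend.unique {π : SPath p q n} {k k' : Fin (n + 1)} (h : π.FirstEventBend k)
    (h' : π.FirstEventBend k') : k = k' :=
  le_antisymm (not_lt.1 fun hlt => h'.2.2 k hlt h.1) (not_lt.1 fun hlt => h.2.2 k' hlt h'.1)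

lemma FirstEventDiagonal.unique {π : SPath p q n} {i i' : Fin n} (h : π.FirstEventDiagonal i)
    (h' : π.FirstEventDiagonal i') : i = i' :=
  le_antisymm (not_lt.1 fun hlt => h'.2.1 i hlt h.1) (not_lt.1 fun hlt => h.2.1 i' hlt h'.1)

/-- The face of an interior target s-path which skips the bend that is its first event. -/
lemma FirstEventBend.face {π : SPath p q (n + 1)} {k : Fin (n + 2)} (h : π.FirstEventBend k)
    (hπ : π.Interior) : (π.face k).Interior ∧
      ∃ i : Fin n, (i : ℕ) + 1 = k ∧ (π.face k).FirstEventDiagonal i := by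
  rw [firstEventBend_iff] at h
  obtain ⟨⟨hk0, hkn, hx, hy⟩, hd, hb⟩ := h
  rw [interior_iff] at hπ
  obtain ⟨⟨x0, xn, xs⟩, y0, yn, ys⟩ := hπ
  obtain ⟨k, hk⟩ := k
  obtain ⟨k, rfl⟩ : ∃ l, k = l + 1 := ⟨k - 1, by dsimp only at hk0; omega⟩
  simp only [Nat.add_sub_cancel] at hx hy hkn hd hb
  have xf {i} (hi : i ≤ n) := π.xc_face ⟨k + 1, hk⟩ hi
  have yf {i} (hi : i ≤ n) := π.yc_face ⟨k + 1, hk⟩ hi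
  simp only at xf yf
  -- Strictness makes the vertical step `k` raise `y` and the horizontal step `k + 1` raise `x`;
  -- merged, they form the diagonal step `k` of the face.
  have s0 := π.step_lt (i := k) (by omega)
  have s1 := π.step_lt (i := k + 1) (by omega)
  refine ⟨(interior_iff _).2 ⟨⟨?_, ?_, fun i hi => ?_⟩, ?_, ?_, fun i hi => ?_⟩,
    ⟨k, by omega⟩, rfl, (firstEventDiagonal_iff _ _).2 ⟨⟨?_, ?_⟩, fun j hj hjn => ?_,
      fun l hl hl' => ?_⟩⟩
  · rw [xf (by omega), if_pos (by omega), x0]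
  · rw [xf le_rfl, if_neg (by omega), xn]
  · have := xs i (by omega)
    rw [xf (by omega), xf (by omega)]
    rcases lt_trichotomy i k with h | rfl | h
    · rwa [if_pos (by omega), if_pos (by omega)]
    · have := xs (i + 1) (by omega)
      rw [if_neg (by omega), if_pos (by omega)]
      omega
    · rw [if_neg (by omega), if_neg (by omega)]
      exact xs (i + 1) (by omega)
  · rw [yf (by omega), if_pos (by omega), y0]
  · rw [yf le_rfl, if_neg (by omega), yn]
  · have := ys i (by omega)
    rw [yf (by omega), yf (by omega)]
    rcases lt_trichotomy i k with h | rfl | h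
    · rwa [if_pos (by omega), if_pos (by omega)]
    · rw [if_neg (by omega), if_pos (by omega)]
      omega
    · rw [if_neg (by omega), if_neg (by omega)]
      exact ys (i + 1) (by omega)
  · dsimp only
    rw [xf (by omega), xf (by omega), if_pos (by omega), if_neg (by omega)]
    omega
  · dsimp only
    rw [yf (by omega), yf (by omega), if_pos (by omega), if_neg (by omega)]
    omega
  · dsimp only at hj
    rw [DiagonalAt, xf (by omega), yf (by omega), xf (by omega), yf (by omega),
      if_neg (by omega), if_neg (by omega), if_neg (by omega), if_neg (by omega)]
    exact hd (j + 1) (by omega) (by omega)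
  · obtain ⟨h0, h1, h2, h3⟩ := hl'
    dsimp only at hl
    rw [xf (by omega), xf (by omega), if_neg (by omega : ¬ l < k + 1)] at h2
    rw [yf (by omega), yf (by omega), if_neg (by omega), if_neg (by omega)] at h3
    -- A bend of the face at `k + 1` would need the new diagonal step to be vertical; a later one,
    -- at `l`, is a bend of `π` at `l + 1`.
    rcases eq_or_lt_of_le (show k + 1 ≤ l by omega) with rfl | hlt
    · rw [if_pos (by omega)] at h2
      simp only [Nat.add_sub_cancel] at h2
      omega
    · rw [if_neg (by omega), Nat.sub_add_cancel (by omega)] at h2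
      exact hb (l + 1) (by omega) ⟨by omega, by omega, h2, h3⟩

/-- An s-path is determined by the face which skips the bend that is its first event. -/
lemma FirstEventBend.eq_of_face_eq {π π' : SPath p q (n + 1)} {k : Fin (n + 2)}
    (h : π.FirstEventBend k) (h' : π'.FirstEventBend k) (e : π.face k = π'.face k) : π = π' := by
  rw [firstEventBend_iff] at h h'
  obtain ⟨⟨hk0, hkn, hx, hy⟩, -, -⟩ := h
  obtain ⟨⟨-, -, hx', hy'⟩, -, -⟩ := h'
  have xe (i : ℕ) (hi : i ≤ n + 1) (hik : i ≠ k) : π.xc i = π'.xc i := by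
    rcases Nat.lt_or_ge i k with h | h
    · have := π.xc_face k (i := i) (by omega)
      have h' := π'.xc_face k (i := i) (by omega)
      rw [if_pos h] at this h'
      rw [← this, ← h', e]
    · obtain ⟨i, rfl⟩ : ∃ l, i = l + 1 := ⟨i - 1, by omega⟩
      have := π.xc_face k (i := i) (by omega)
      have h' := π'.xc_face k (i := i) (by omega)
      rw [if_neg (by omega)] at this h'
      rw [← this, ← h', e]
  have ye (i : ℕ) (hi : i ≤ n + 1) (hik : i ≠ k) : π.yc i = π'.yc i := by
    rcases Nat.lt_or_ge i k with h | h
    · have := π.yc_face k (i := i) (by omega)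
      have h' := π'.yc_face k (i := i) (by omega)
      rw [if_pos h] at this h'
      rw [← this, ← h', e]
    · obtain ⟨i, rfl⟩ : ∃ l, i = l + 1 := ⟨i - 1, by omega⟩
      have := π.yc_face k (i := i) (by omega)
      have h' := π'.yc_face k (i := i) (by omega)
      rw [if_neg (by omega)] at this h'
      rw [← this, ← h', e]
  -- The skipped corner is recovered from its neighbours: it has the `x` of the point before it and
  -- the `y` of the point after it.
  refine ext_coord (fun i hi => ?_) (fun i hi => ?_)
  · by_cases hik : i = k
    · rw [hik, ← hx, ← hx', xe _ (by omega) (by omega)]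
    · exact xe i hi hik
  · by_cases hik : i = k
    · rw [hik, hy, hy', ye _ (by omega) (by omega)]
    · exact ye i hi hik

/-- Every interior source s-path is obtained by skipping the first event of an interior target
s-path. -/
lemma IsSource.exists_face_eq {π : SPath p q n} (h : π.IsSource) (hπ : π.Interior) :
    ∃ (π' : SPath p q (n + 1)) (k : Fin (n + 2)), π'.Interior ∧ π'.FirstEventBend k ∧
      π'.face k = π := by
  obtain ⟨⟨i, hi⟩, h⟩ := h
  rw [firstEventDiagonal_iff] at h
  obtain ⟨⟨hx, hy⟩, hd, hb⟩ := h
  rw [interior_iff] at hπ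
  obtain ⟨⟨x0, xn, xs⟩, y0, yn, ys⟩ := hπ
  dsimp only at hx hy hd hb
  -- The diagonal step `i` is subdivided by the corner `(x_i, y_{i+1})`, inserted as the point `i +
  -- 1`; the later points are shifted by one.
  let x (j : ℕ) : ℕ := if j ≤ i then π.xc j else π.xc (j - 1)
  let y (j : ℕ) : ℕ := if j ≤ i then π.yc j else if j = i + 1 then π.yc j else π.yc (j - 1)
  have xle {j} (h : j ≤ i) : x j = π.xc j := if_pos h
  have xgt {j} (h : i ≤ j) : x (j + 1) = π.xc j := by
    simp only [x]
    rw [if_neg (by omega), Nat.add_sub_cancel]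
  have yle {j} (h : j ≤ i + 1) : y j = π.yc j := by
    simp only [y]
    split_ifs <;> first | rfl | omega
  have ygt {j} (h : i < j) : y (j + 1) = π.yc j := by
    simp only [y]
    rw [if_neg (by omega), if_neg (by omega), Nat.add_sub_cancel]
  have step : ∀ j < n + 1, (x j ≤ x (j + 1) ∧ y j ≤ y (j + 1) ∧
      x j + y j < x (j + 1) + y (j + 1)) ∧ x (j + 1) ≤ x j + 1 ∧ y (j + 1) ≤ y j + 1 := by
    intro j hj
    rcases lt_trichotomy j i with h | rfl | h
    · rw [xle h.le, xle h, yle (by omega), yle (by omega)]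
      have := π.step_lt (i := j) (by omega)
      exact ⟨⟨π.xc_mono (by omega), π.yc_mono (by omega), this⟩, xs j (by omega), ys j (by omega)⟩
    · rw [xle le_rfl, xgt le_rfl, yle (by omega), yle (by omega)]
      have := π.yc_mono (show j ≤ j + 1 by omega)
      have := ys j hi
      omega
    · obtain ⟨j, rfl⟩ : ∃ l, j = l + 1 := ⟨j - 1, by omega⟩
      rw [xgt (by omega), xgt (by omega), ygt h]
      have := π.step_lt (i := j) (by omega)
      have := π.xc_mono (show j ≤ j + 1 by omega)
      have := π.yc_mono (show j ≤ j + 1 by omega)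
      have := xs j (by omega)
      have := ys j (by omega)
      rcases eq_or_lt_of_le (show i ≤ j by omega) with rfl | hlt
      · rw [yle le_rfl]
        omega
      · rw [ygt hlt]
        omega
  have xb : ∀ j ≤ n + 1, x j ≤ p := fun j _ => by
    simp only [x]
    split_ifs <;> exact π.xc_le _
  have yb : ∀ j ≤ n + 1, y j ≤ q := fun j _ => by
    simp only [y]
    split_ifs <;> exact π.yc_le _
  let π' : SPath p q (n + 1) := ofCoord x y xb yb fun j hj => (step j hj).1
  have xπ {j} (h : j ≤ n + 1) : π'.xc j = x j := xc_ofCoord h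
  have yπ {j} (h : j ≤ n + 1) : π'.yc j = y j := yc_ofCoord h
  refine ⟨π', ⟨i + 1, by omega⟩, (interior_iff _).2 ⟨⟨?_, ?_, fun j hj => ?_⟩, ?_, ?_,
    fun j hj => ?_⟩, (firstEventBend_iff _ _).2 ⟨⟨by simp, by dsimp only; omega, ?_, ?_⟩,
      fun j hj hjn => ?_, fun l hl hl' => ?_⟩, ext_coord (fun j hj => ?_) (fun j hj => ?_)⟩
  · rw [xπ (by omega), xle (by omega), x0]
  · rw [xπ le_rfl, xgt (by omega), xn]
  · rw [xπ (by omega), xπ (by omega)]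
    exact (step j hj).2.1
  · rw [yπ (by omega), yle (by omega), y0]
  · rw [yπ le_rfl, ygt (by omega), yn]
  · rw [yπ (by omega), yπ (by omega)]
    exact (step j hj).2.2
  · dsimp only
    rw [xπ (by omega), xπ (by omega), Nat.add_sub_cancel, xle le_rfl, xgt le_rfl]
  · dsimp only
    rw [yπ (by omega), yπ (by omega), yle le_rfl, ygt (by omega)]
  · dsimp only at hj
    rw [DiagonalAt, xπ (by omega), xπ (by omega), yπ (by omega), yπ (by omega)]
    rcases eq_or_lt_of_le hj with rfl | hlt
    · rw [yle le_rfl, ygt (by omega)]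
      exact fun h => h.2 rfl
    · obtain ⟨j, rfl⟩ : ∃ l, j = l + 1 := ⟨j - 1, by omega⟩
      rw [xgt (by omega), xgt (by omega), ygt (by omega), ygt (by omega)]
      exact hd j (by omega) (by omega)
  · obtain ⟨h0, h1, h2, h3⟩ := hl'
    dsimp only at hl
    obtain ⟨l, rfl⟩ : ∃ m, l = m + 2 := ⟨l - 2, by omega⟩
    rw [xπ (by omega), xπ (by omega), show l + 2 - 1 = l + 1 by omega, xgt (by omega),
      xgt (by omega)] at h2
    rw [yπ (by omega), yπ (by omega), ygt (by omega), ygt (by omega)] at h3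
    exact hb (l + 1) (by omega) ⟨by omega, by omega, by simpa using h2, h3⟩
  · rw [xc_face _ _ hj, xπ (by omega), xπ (by omega)]
    split_ifs with h
    · exact xle (by dsimp only at h; omega)
    · exact xgt (by dsimp only at h; omega)
  · rw [yc_face _ _ hj, yπ (by omega), yπ (by omega)]
    split_ifs with h
    · exact yle (by dsimp only at h; omega)
    · exact ygt (by dsimp only at h; omega)

/-! ### Critical interior s-paths -/

lemma interior_last (p q : ℕ) : (last p q).Interior := by
  have hx {i} (hi : i ≤ p + q) : (last p q).xc i = min i p := by simp [xc, last, hi]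
  have hy {i} (hi : i ≤ p + q) : (last p q).yc i = i - p := by simp [yc, last, hi]
  refine (interior_iff _).2 ⟨⟨?_, ?_, fun i hi => ?_⟩, ?_, ?_, fun i hi => ?_⟩
  · simp [hx]
  · simp [hx]
  · rw [hx (by omega), hx (by omega)]
    omega
  · simp [hy]
  · simp [hy]
  · rw [hy (by omega), hy (by omega)]
    omega

lemma isCritical_last (p q : ℕ) : (last p q).IsCritical := by
  have hx {i} (hi : i ≤ p + q) : (last p q).xc i = min i p := by simp [xc, last, hi]
  have hy {i} (hi : i ≤ p + q) : (last p q).yc i = i - p := by simp [yc, last, hi]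
  refine (isCritical_iff _).2 ⟨fun i hi => ?_, fun k ⟨h0, h1, h2, h3⟩ => ?_⟩
  · rw [DiagonalAt, hx (by omega), hx (by omega), hy (by omega), hy (by omega)]
    omega
  · rw [hx (by omega), hx (by omega)] at h2
    rw [hy (by omega), hy (by omega)] at h3
    omega

/-- The coordinates of a critical interior s-path are those of the last simplex. -/
lemma IsCritical.coord_eq {π : SPath p q n} (h : π.IsCritical) (hπ : π.Interior) :
    n = p + q ∧ ∀ i ≤ n, π.xc i = min i p ∧ π.yc i = i - p := by
  rw [isCritical_iff] at h
  obtain ⟨hd, hb⟩ := h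
  rw [interior_iff] at hπ
  obtain ⟨⟨x0, xn, xs⟩, y0, yn, ys⟩ := hπ
  have step (i : ℕ) (hi : i < n) : (π.xc (i + 1) = π.xc i ∧ π.yc (i + 1) = π.yc i + 1) ∨
      (π.xc (i + 1) = π.xc i + 1 ∧ π.yc (i + 1) = π.yc i) := by
    have := π.step_lt hi
    have := xs i hi
    have := ys i hi
    have := π.xc_mono (show i ≤ i + 1 by omega)
    have := π.yc_mono (show i ≤ i + 1 by omega)
    have := hd i hi
    rw [DiagonalAt] at this
    omega
  -- Without diagonals every step raises `x + y` by exactly one, which also gives `n = p + q`.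
  have sum : ∀ i ≤ n, π.xc i + π.yc i = i := by
    intro i
    induction i with
    | zero => intro _; omega
    | succ i ih =>
      intro hi
      have := ih (by omega)
      have := step i hi
      omega
  -- Without bends or diagonals, a vertical step is followed only by vertical steps, so `x` has
  -- already reached `p`.
  have const (i : ℕ) (hi : i < n) (hv : π.xc (i + 1) = π.xc i) : π.xc i = p := by
    have : ∀ j, i + 1 + j ≤ n → π.xc (i + j) = π.xc i ∧ π.xc (i + 1 + j) = π.xc i := by
      intro j
      induction j with
      | zero => exact fun _ => ⟨rfl, hv⟩
      | succ j ih =>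
        intro hj
        obtain ⟨h1, h2⟩ := ih (by omega)
        refine ⟨by rw [← h2]; congr 1; omega, ?_⟩
        rcases step (i + 1 + j) (by omega) with h | h
        · rw [← h2, ← h.1]
          rfl
        · refine absurd ⟨by omega, by omega, ?_, h.2.symm⟩ (hb (i + 1 + j))
          rw [h2, ← h1]
          congr 1
          omega
    have := (this (n - (i + 1)) (by omega)).2
    rwa [Nat.add_sub_cancel' hi, xn, eq_comm] at this
  have hx : ∀ i ≤ n, π.xc i = min i p := by
    intro i
    induction i with
    | zero => intro _; omega
    | succ i ih =>
      intro hi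
      have h1 := ih (by omega)
      have h2 := π.xc_le (i + 1)
      rcases step i hi with h | h
      · have := const i hi h.1
        omega
      · omega
  have hn := sum n le_rfl
  refine ⟨by omega, fun i hi => ⟨hx i hi, ?_⟩⟩
  have := sum i hi
  have := hx i hi
  omega

lemma IsCritical.eq_last {π : SPath p q (p + q)} (h : π.IsCritical) (hπ : π.Interior) :
    π = last p q := by
  have h1 := (h.coord_eq hπ).2
  have h2 := ((isCritical_last p q).coord_eq (interior_last p q)).2
  exact ext_coord (fun i hi => by rw [(h1 i hi).1, (h2 i hi).1])
    (fun i hi => by rw [(h1 i hi).2, (h2 i hi).2])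

/-- The sum of `a + q - b` for the points `(a, b)` of an s-path. -/
def weight (π : SPath p q n) : ℕ := ∑ i : Fin (n + 1), (((π.pt i).1 : ℕ) + (q - ((π.pt i).2 : ℕ)))

lemma weight_le (π : SPath p q n) : π.weight ≤ (n + 1) * (p + q) := by
  have h : π.weight ≤ ∑ _i : Fin (n + 1), (p + q) := Finset.sum_le_sum fun i _ => by omega
  simpa using h

/-- Comparing the weights of two faces of the same s-path amounts to comparing the skipped points:
skipping a heavier point leaves a lighter face. -/
lemma weight_face (π : SPath p q (n + 1)) (k : Fin (n + 2)) :
    π.weight = ((π.pt k).1 : ℕ) + (q - ((π.pt k).2 : ℕ)) + (π.face k).weight :=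
  Fin.sum_univ_succAbove _ k

/-- The other faces of a target s-path which are source s-paths have a smaller weight than the
face which skips the first event. -/
lemma FirstEventBend.weight_face_lt {π : SPath p q (n + 1)} {j k : Fin (n + 2)}
    (h : π.FirstEventBend k) (hπ : π.Interior) (hjk : j ≠ k) (hj : (π.face j).Interior)
    (hs : (π.face j).IsSource) : (π.face j).weight < (π.face k).weight := by
  have h1 := π.weight_face j
  have h2 := π.weight_face k
  suffices π.xc k + (q - π.yc k) < π.xc j + (q - π.yc j) by
    rw [pt_fst, pt_snd] at h1 h2
    omega
  clear h1 h2
  have yj := π.yc_le j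
  have yk := π.yc_le k
  have hk := (firstEventBend_iff _ _).1 h
  obtain ⟨⟨hk0, hkn, hx, hy⟩, hd, hb⟩ := hk
  rw [interior_iff] at hπ hj
  obtain ⟨⟨x0, xn, xs⟩, y0, yn, ys⟩ := hπ
  obtain ⟨⟨x0', xn', xs'⟩, y0', yn', ys'⟩ := hj
  rcases lt_trichotomy (j : ℕ) k with hlt | heq | hgt
  -- Skipping a point before `k - 1` leaves the bend as first event, now at `k - 1`; the face would
  -- be a target.
  · have hj1 : (j : ℕ) + 1 = k := by
      by_contra hne
      refine not_isSource_and_isTarget _ ⟨hs, ⟨⟨k - 1, by omega⟩, (firstEventBend_iff _ _).2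
        ⟨⟨by dsimp only; omega, by dsimp only; omega, ?_, ?_⟩, fun i hi hin => ?_,
          fun l hl hl' => ?_⟩⟩⟩
      · dsimp only
        rw [xc_face _ _ (by omega), xc_face _ _ (by omega), if_neg (by omega), if_neg (by omega),
          Nat.sub_add_cancel (by omega), Nat.sub_add_cancel (by omega), hx]
      · dsimp only
        rw [yc_face _ _ (by omega), yc_face _ _ (by omega), if_neg (by omega), if_neg (by omega),
          Nat.sub_add_cancel (by omega), hy]
      · dsimp only at hi
        rw [DiagonalAt, xc_face _ _ (by omega), xc_face _ _ (by omega), yc_face _ _ (by omega),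
          yc_face _ _ (by omega), if_neg (by omega), if_neg (by omega), if_neg (by omega),
          if_neg (by omega)]
        exact hd (i + 1) (by omega) (by omega)
      · obtain ⟨h0, h1, h2, h3⟩ := hl'
        dsimp only at hl
        rw [xc_face _ _ (by omega), xc_face _ _ (by omega), if_neg (by omega), if_neg (by omega),
          Nat.sub_add_cancel (by omega)] at h2
        rw [yc_face _ _ (by omega), yc_face _ _ (by omega), if_neg (by omega),
          if_neg (by omega)] at h3
        exact hb (l + 1) (by omega) ⟨by omega, by omega, h2, h3⟩
    -- The step from `j` to `k` is vertical, so the point `j` is lower than the bend and weighs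
    -- more.
    have := π.step_lt (i := j) (by omega)
    rw [← hj1, Nat.add_sub_cancel] at hx
    rw [← hj1] at yk ⊢
    omega
  · exact absurd (Fin.ext heq) hjk
  · -- the step before the point `j` is horizontal
    obtain ⟨j, hj⟩ := j
    dsimp only at *
    obtain ⟨j, rfl⟩ : ∃ l, j = l + 1 := ⟨j - 1, by omega⟩
    have hh : π.yc j = π.yc (j + 1) := by
      by_contra hne
      -- A vertical step into the skipped point contradicts interiority of the face: if the point is
      -- the last one, `q` is no longer reached; otherwise no bend is allowed there, so the next
      -- step raises `y` too and the face jumps by two.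
      have hv : π.xc j = π.xc (j + 1) := by
        by_contra hne'
        exact hd j (by omega) (by omega) ⟨hne', hne⟩
      have hlt := π.yc_mono (show j ≤ j + 1 by omega)
      rcases eq_or_lt_of_le (show j ≤ n by omega) with rfl | hjn
      · rw [yc_face _ _ le_rfl, if_pos (by simp)] at yn'
        omega
      · have h1 : π.yc (j + 1) ≠ π.yc (j + 1 + 1) := fun e =>
          hb (j + 1) (by omega) ⟨by omega, by omega, by simpa using hv, e⟩
        have h2 := π.yc_mono (show j + 1 ≤ j + 1 + 1 by omega)
        have h3 := ys' j hjn
        rw [yc_face _ _ (by omega), yc_face _ _ (by omega), if_neg (by simp),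
          if_pos (by simp)] at h3
        omega
    -- With no event after `k`, whatever precedes a horizontal step is horizontal, back to the bend.
    -- The skipped point is thus on the same row as the bend and to its right.
    have back : ∀ i, i + k ≤ j → π.yc (j - i) = π.yc (j + 1) ∧
        π.yc (j - i) = π.yc (j - i + 1) := by
      intro i
      induction i with
      | zero => exact fun _ => ⟨hh, hh⟩
      | succ i ih =>
        intro hi
        obtain ⟨e1, e2⟩ := ih (by omega)
        have e3 : j - i = j - (i + 1) + 1 := by omega
        have e4 : π.yc (j - (i + 1)) = π.yc (j - i) := by
          by_contra hne
          rw [e3] at hne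
          refine hb (j - i) (by omega) ⟨by omega, by omega, ?_, e2⟩
          by_contra hne'
          refine hd (j - (i + 1)) (by omega) (by omega) ⟨?_, hne⟩
          rw [← e3]
          rwa [Nat.sub_sub] at hne'
        refine ⟨e4.trans e1, e4.trans ?_⟩
        rw [← e3]
    have e := (back (j - k) (by omega)).1
    rw [Nat.sub_sub_self (by omega)] at e
    have h1 := π.step_lt (i := k) (by omega)
    have h2 := π.xc_mono (show (k : ℕ) + 1 ≤ j + 1 by omega)
    omega

end SPath

/-! ### The canonical writing of the simplices of a product -/

namespace SSet

variable {X Y : SSet.{u}}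

/-- Pulling back along a section of `f'` exhibits `σ'` as a face operator applied to `σ`; when `σ'`
is non-degenerate, that operator must be a monomorphism. -/
lemma map_section_comp {n m m' : ℕ} {f : ⦋n⦌ ⟶ ⦋m⦌} {f' : ⦋n⦌ ⟶ ⦋m'⦌} (s : SplitEpi f')
    {σ : X _⦋m⦌} {σ' : X _⦋m'⦌} (h : X.map f.op σ = X.map f'.op σ') :
    X.map (s.section_ ≫ f).op σ = σ' := by
  rw [op_comp, Functor.map_comp, comp_apply, h, ← comp_apply, ← Functor.map_comp, ← op_comp,
    SplitEpi.id, op_id, CategoryTheory.Functor.map_id, id_apply]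

lemma dim_le_of_map_eq_map {n m m' : ℕ} {f : ⦋n⦌ ⟶ ⦋m⦌} {f' : ⦋n⦌ ⟶ ⦋m'⦌} [Epi f']
    {σ : X _⦋m⦌} {σ' : X.nonDegenerate m'} (h : X.map f.op σ = X.map f'.op σ'.1) : m' ≤ m := by
  obtain ⟨⟨s⟩⟩ := isSplitEpi_of_epi f'
  have := X.mono_of_nonDegenerate σ' (s.section_ ≫ f) σ (map_section_comp s h)
  exact SimplexCategory.len_le_of_mono (s.section_ ≫ f)

/-- A monomorphism from `⦋m⦌` to itself is the identity, so a section of `f'` is also a section of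
`f`. -/
lemma epi_of_map_eq_map {n m : ℕ} {f f' : ⦋n⦌ ⟶ ⦋m⦌} [Epi f']
    {σ : X _⦋m⦌} {σ' : X.nonDegenerate m} (h : X.map f.op σ = X.map f'.op σ'.1) : Epi f := by
  obtain ⟨⟨s⟩⟩ := isSplitEpi_of_epi f'
  have := X.mono_of_nonDegenerate σ' (s.section_ ≫ f) σ (map_section_comp s h)
  have e := SimplexCategory.eq_id_of_mono (s.section_ ≫ f)
  exact (SplitEpi.mk s.section_ e).epi

/-- By uniqueness of the canonical writing, `f` factors through the degeneracy `σ i`, which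
identifies the vertices `i` and `i + 1`. -/
lemma eq_of_map_eq_σ {n m : ℕ} {f : ⦋n + 1⦌ ⟶ ⦋m⦌} [Epi f] {σ : X.nonDegenerate m}
    {i : Fin (n + 1)} {y : X _⦋n⦌} (h : X.map f.op σ.1 = X.σ i y) :
    f i.castSucc = f i.succ := by
  obtain ⟨m', f', _, σ', rfl⟩ := X.exists_nonDegenerate y
  have h' : X.map f.op σ.1 = X.map (SimplexCategory.σ i ≫ f').op σ'.1 := by
    rw [h, op_comp, Functor.map_comp, comp_apply]
    rfl
  obtain rfl := X.unique_nonDegenerate_dim _ f σ rfl _ σ' h'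
  rw [X.unique_nonDegenerate_map _ f σ rfl _ σ' h']
  change f' (i.predAbove i.castSucc) = f' (i.predAbove i.succ)
  rw [Fin.predAbove_castSucc_self, Fin.predAbove_succ_self]

end SSet

namespace SPath

variable {X Y : SSet.{u}} {p q n : ℕ}

lemma simplex_eq_iff {p' q' : ℕ} {π : SPath p q n} {π' : SPath p' q' n} {σ : X _⦋p⦌} {τ : Y _⦋q⦌}
    {σ' : X _⦋p'⦌} {τ' : Y _⦋q'⦌} : π.simplex σ τ = π'.simplex σ' τ' ↔
      X.map π.fst.op σ = X.map π'.fst.op σ' ∧ Y.map π.snd.op τ = Y.map π'.snd.op τ' :=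
  Prod.mk_inj

lemma epi_fst {π : SPath p q n} (h : π.Interior) : Epi π.fst :=
  SimplexCategory.epi_iff_surjective.2 h.1

lemma epi_snd {π : SPath p q n} (h : π.Interior) : Epi π.snd :=
  SimplexCategory.epi_iff_surjective.2 h.2

lemma interior_of_epi {π : SPath p q n} (h : Epi π.fst) (h' : Epi π.snd) : π.Interior :=
  ⟨SimplexCategory.epi_iff_surjective.1 h, SimplexCategory.epi_iff_surjective.1 h'⟩

lemma δ_simplex (π : SPath p q (n + 1)) (j : Fin (n + 2)) (σ : X _⦋p⦌) (τ : Y _⦋q⦌) :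
    (X ⊗ Y : SSet.{u}).δ j (π.simplex σ τ) = (π.face j).simplex σ τ := by
  have hx : X.map (SimplexCategory.δ j).op (X.map π.fst.op σ) = X.map (π.face j).fst.op σ := by
    rw [← comp_apply, ← Functor.map_comp, ← op_comp]
    rfl
  have hy : Y.map (SimplexCategory.δ j).op (Y.map π.snd.op τ) = Y.map (π.face j).snd.op τ := by
    rw [← comp_apply, ← Functor.map_comp, ← op_comp]
    rfl
  exact Prod.ext hx hy

end SPath

/-- The data which code a non-degenerate `n`-simplex of `X × Y`. -/
structure SPathCode (X Y : SSet.{u}) (n : ℕ) where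
  /-- the dimension of the component in `X` -/
  p : ℕ
  /-- the dimension of the component in `Y` -/
  q : ℕ
  /-- the component in `X` -/
  σ : X.nonDegenerate p
  /-- the component in `Y` -/
  τ : Y.nonDegenerate q
  /-- the s-path -/
  π : SPath p q n
  interior : π.Interior

namespace SPathCode

variable {X Y : SSet.{u}} {n : ℕ}

/-- The simplex of `X × Y` which is coded. -/
def simplex (c : SPathCode X Y n) : (X ⊗ Y : SSet.{u}) _⦋n⦌ := c.π.simplex c.σ.1 c.τ.1

/-- Uniqueness in the Eilenberg-Zilber lemma, applied to both components, recovers `σ`, `τ` and the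
two projections, hence the s-path. -/
lemma simplex_injective : Function.Injective (simplex (X := X) (Y := Y) (n := n)) := by
  rintro ⟨p, q, σ, τ, π, hπ⟩ ⟨p', q', σ', τ', π', hπ'⟩ h
  obtain ⟨hx, hy⟩ := SPath.simplex_eq_iff.1 h
  have := SPath.epi_fst hπ
  have := SPath.epi_snd hπ
  have := SPath.epi_fst hπ'
  have := SPath.epi_snd hπ'
  obtain rfl := X.unique_nonDegenerate_dim _ π.fst σ rfl π'.fst σ' hx
  obtain rfl := Y.unique_nonDegenerate_dim _ π.snd τ rfl π'.snd τ' hy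
  obtain rfl := X.unique_nonDegenerate_simplex _ π.fst σ rfl π'.fst σ' hx
  obtain rfl := Y.unique_nonDegenerate_simplex _ π.snd τ rfl π'.snd τ' hy
  have h1 := X.unique_nonDegenerate_map _ π.fst σ rfl π'.fst σ hx
  have h2 := Y.unique_nonDegenerate_map _ π.snd τ rfl π'.snd τ hy
  have : π = π' := by
    obtain ⟨f, hf⟩ := π
    obtain ⟨f', hf'⟩ := π'
    congr
    funext i
    exact Prod.ext (SimplexCategory.congr_toOrderHom_apply h1 i)
      (SimplexCategory.congr_toOrderHom_apply h2 i)
  subst this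
  rfl

/-- A simplex which is coded, in a prism, by an s-path that is not assumed to be interior comes
from a smaller prism unless the s-path is interior. -/
lemma le_of_simplex_eq (c : SPathCode X Y n) {p q : ℕ} {σ : X _⦋p⦌} {τ : Y _⦋q⦌}
    {π : SPath p q n} (h : π.simplex σ τ = c.simplex) :
    c.p ≤ p ∧ c.q ≤ q ∧ (c.p + c.q = p + q → π.Interior) := by
  obtain ⟨p', q', σ', τ', π', hπ'⟩ := c
  obtain ⟨hx, hy⟩ := SPath.simplex_eq_iff.1 h
  have := SPath.epi_fst hπ'
  have := SPath.epi_snd hπ'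
  have hp : p' ≤ p := SSet.dim_le_of_map_eq_map hx
  have hq : q' ≤ q := SSet.dim_le_of_map_eq_map hy
  refine ⟨hp, hq, fun e => ?_⟩
  dsimp only at e
  obtain rfl : p' = p := by omega
  obtain rfl : q' = q := by omega
  exact SPath.interior_of_epi (SSet.epi_of_map_eq_map hx) (SSet.epi_of_map_eq_map hy)

/-- A common degeneracy index would make two consecutive points of the s-path equal. -/
lemma simplex_mem_nonDegenerate (c : SPathCode X Y n) :
    c.simplex ∈ (X ⊗ Y : SSet.{u}).nonDegenerate n := by
  intro hd
  obtain _ | n := n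
  · rw [SSet.degenerate_zero] at hd
    exact hd
  · rw [SSet.degenerate_eq_iUnion_range_σ, Set.mem_iUnion] at hd
    obtain ⟨i, y, hy⟩ := hd
    have := SPath.epi_fst c.interior
    have := SPath.epi_snd c.interior
    have h1 : c.π.fst i.castSucc = c.π.fst i.succ :=
      SSet.eq_of_map_eq_σ (y := y.1) (congrArg Prod.fst hy.symm)
    have h2 : c.π.snd i.castSucc = c.π.snd i.succ :=
      SSet.eq_of_map_eq_σ (y := y.2) (congrArg Prod.snd hy.symm)
    exact (c.π.strictMono i.castSucc_lt_succ).ne (Prod.ext h1 h2)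

/-- The canonical writings of the two components give the projections. Two equal consecutive points
would yield a degeneracy shared by both components, so the sequence is strictly increasing. -/
lemma exists_simplex_eq (ρ : (X ⊗ Y : SSet.{u}).nonDegenerate n) :
    ∃ c : SPathCode X Y n, c.simplex = ρ.1 := by
  obtain ⟨⟨x, y⟩, hρ⟩ := ρ
  obtain ⟨p, f, hf, σ, hx⟩ := X.exists_nonDegenerate x
  obtain ⟨q, g, hg, τ, hy⟩ := Y.exists_nonDegenerate y
  have hmono : StrictMono fun i : Fin (n + 1) => (f i, g i) := by
    obtain _ | n := n
    · exact fun a b h => absurd h (by omega)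
    · rw [Fin.strictMono_iff_lt_succ]
      intro i
      refine lt_of_le_of_ne ⟨f.toOrderHom.monotone i.castSucc_lt_succ.le,
        g.toOrderHom.monotone i.castSucc_lt_succ.le⟩ fun e => hρ ?_
      rw [Prod.mk_inj] at e
      obtain ⟨f', rfl⟩ := SimplexCategory.eq_σ_comp_of_not_injective' f i e.1
      obtain ⟨g', rfl⟩ := SimplexCategory.eq_σ_comp_of_not_injective' g i e.2
      rw [op_comp, Functor.map_comp, comp_apply] at hx hy
      have := (X ⊗ Y : SSet.{u}).σ_mem_degenerate i (X.map f'.op σ.1, Y.map g'.op τ.1)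
      subst hx hy
      exact this
  let π : SPath p q n := ⟨fun i => (f i, g i), hmono⟩
  have ef : π.fst = f := by ext; rfl
  have eg : π.snd = g := by ext; rfl
  refine ⟨⟨p, q, σ, τ, π, SPath.interior_of_epi (ef ▸ hf) (eg ▸ hg)⟩, ?_⟩
  subst hx hy
  simp only [SPathCode.simplex, SPath.simplex, ef, eg]
  rfl

/-- The code of a non-degenerate simplex. -/
noncomputable def ofNonDegenerate (ρ : (X ⊗ Y : SSet.{u}).nonDegenerate n) : SPathCode X Y n :=
  (exists_simplex_eq ρ).choose

lemma simplex_ofNonDegenerate (ρ : (X ⊗ Y : SSet.{u}).nonDegenerate n) :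
    (ofNonDegenerate ρ).simplex = ρ.1 := (exists_simplex_eq ρ).choose_spec

lemma ofNonDegenerate_eq {ρ : (X ⊗ Y : SSet.{u}).nonDegenerate n} {c : SPathCode X Y n}
    (h : c.simplex = ρ.1) : ofNonDegenerate ρ = c :=
  simplex_injective ((simplex_ofNonDegenerate ρ).trans h.symm)

lemma ofNonDegenerate_injective :
    Function.Injective (ofNonDegenerate (X := X) (Y := Y) (n := n)) := fun ρ ρ' h =>
  Subtype.ext (by rw [← simplex_ofNonDegenerate ρ, h, simplex_ofNonDegenerate])

end SPathCode

lemma hasSPath_iff {X Y : SSet.{u}} {n : ℕ} (ρ : (X ⊗ Y : SSet.{u}).nonDegenerate n)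
    (P : ∀ {p q : ℕ}, SPath p q n → Prop) :
    HasSPath ρ.1 P ↔ P (SPathCode.ofNonDegenerate ρ).π := by
  constructor
  · rintro ⟨p, q, σ, τ, π, hπ, e, h⟩
    rw [SPathCode.ofNonDegenerate_eq (c := ⟨p, q, σ, τ, π, hπ⟩) e.symm]
    exact h
  · intro h
    exact ⟨_, _, _, _, _, (SPathCode.ofNonDegenerate ρ).interior,
      (SPathCode.simplex_ofNonDegenerate ρ).symm, h⟩

/-! ### Incidence numbers of the normalized chain complex -/

namespace SSet

variable (k : Type) [CommRing k] (X : SSet.{u})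

lemma normGen_eq_zero {n : ℕ} {x : X _⦋n⦌} (hx : x ∈ X.degenerate n) : X.normGen k x = 0 := by
  rw [normGen, ιNormalizedChainComplex_eq_zero _ _ hx]
  rfl

lemma d_normGen {n : ℕ} (x : X _⦋n + 1⦌) :
    ((X.normalizedChainComplex (coeff.{u} k)).d (n + 1) n).hom (X.normGen k x) =
      ∑ i : Fin (n + 2), (-1 : ℤ) ^ (i : ℕ) • X.normGen k (X.δ i x) := by
  have h := congrArg (fun f => f.hom (ULift.up 1))
    (X.ιNormalizedChainComplex_d (R := coeff.{u} k) x)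
  refine h.trans ?_
  simp only [ModuleCat.hom_sum, LinearMap.sum_apply]
  rfl

open Classical in
lemma normBasis_repr_normGen {n : ℕ} (x : X _⦋n⦌) (ρ : X.nonDegenerate n) :
    (X.normBasis k n).repr (X.normGen k x) ρ = if x = ρ.1 then 1 else 0 := by
  by_cases hx : x ∈ X.nonDegenerate n
  · have := X.normBasis_apply k ⟨x, hx⟩
    rw [← this, Module.Basis.repr_self, Finsupp.single_apply]
    simp only [Subtype.ext_iff]
  · rw [normGen_eq_zero _ _ ((X.mem_degenerate_iff_notMem_nonDegenerate x).2 hx), map_zero,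
      if_neg fun e : x = ρ.1 => hx (e ▸ ρ.2)]
    rfl

open Classical in
-- Distinct face indices may give the same simplex, so the incidence number is a sum of signs.
lemma incidence_normalizedACC {n : ℕ} (ρ : X.nonDegenerate n) (ρ' : X.nonDegenerate (n + 1)) :
    (X.normalizedACC ℤ).incidence (p := n) ρ ρ' =
      ∑ i : Fin (n + 2), if X.δ i ρ'.1 = ρ.1 then (-1 : ℤ) ^ (i : ℕ) else 0 := by
  have h : (X.normalizedACC ℤ).incidence (p := n) ρ ρ' = (X.normBasis ℤ n).repr
      (((X.normalizedChainComplex (coeff.{u} ℤ)).d (n + 1) n).hom (X.normBasis ℤ (n + 1) ρ')) ρ :=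
    rfl
  rw [h, normBasis_apply, d_normGen, map_sum, Finsupp.finsetSum_apply]
  refine Finset.sum_congr rfl fun i _ => ?_
  rw [map_zsmul, Finsupp.smul_apply, normBasis_repr_normGen]
  simp

end SSet

/-! ### The Eilenberg-Zilber vector field -/

lemma SPath.face_injective {p q n : ℕ} (π : SPath p q (n + 1)) : Function.Injective π.face := by
  intro j k h
  by_contra hne
  obtain ⟨i, hi⟩ := Fin.exists_succAbove_eq (Ne.symm hne)
  have h1 : π.pt (j.succAbove i) = π.pt (k.succAbove i) := congrArg (fun π' => SPath.pt π' i) h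
  exact Fin.succAbove_ne k i (π.strictMono.injective (hi ▸ h1)).symm

namespace SPathCode

variable {X Y : SSet.{u}} {n : ℕ}

/-- The code of the face which skips the first event of a target s-path. -/
def faceAt (c : SPathCode X Y (n + 1)) {k : Fin (n + 2)} (h : c.π.FirstEventBend k) :
    SPathCode X Y n :=
  ⟨c.p, c.q, c.σ, c.τ, c.π.face k, (h.face c.interior).1⟩

lemma isSource_faceAt (c : SPathCode X Y (n + 1)) {k : Fin (n + 2)} (h : c.π.FirstEventBend k) :
    (c.faceAt h).π.IsSource := by
  obtain ⟨i, -, hi⟩ := (h.face c.interior).2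
  exact ⟨i, hi⟩

/-- A non-interior face is degenerate in some direction or lies in the boundary of the prism, so its
code has a smaller total dimension; otherwise uniqueness of codes applies. -/
lemma eq_of_δ_simplex_eq {c : SPathCode X Y (n + 1)} {c' : SPathCode X Y n} {j : Fin (n + 2)}
    (h : (X ⊗ Y : SSet.{u}).δ j c.simplex = c'.simplex) :
    c'.p + c'.q < c.p + c.q ∨
      ∃ hI : (c.π.face j).Interior, c' = ⟨c.p, c.q, c.σ, c.τ, c.π.face j, hI⟩ := by
  have e : (c.π.face j).simplex c.σ.1 c.τ.1 = c'.simplex := (c.π.δ_simplex j _ _).symm.trans h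
  obtain ⟨hp, hq, hI⟩ := c'.le_of_simplex_eq e
  rcases Nat.lt_or_ge (c'.p + c'.q) (c.p + c.q) with hlt | hge
  · exact Or.inl hlt
  · have hI' := hI (by omega)
    exact Or.inr ⟨hI', simplex_injective (e.symm : _ = simplex ⟨_, _, _, _, _, hI'⟩)⟩

lemma mk_face_eq_faceAt_iff {c : SPathCode X Y (n + 1)} {j k : Fin (n + 2)}
    {hI : (c.π.face j).Interior} {h : c.π.FirstEventBend k} :
    (⟨c.p, c.q, c.σ, c.τ, c.π.face j, hI⟩ : SPathCode X Y n) = c.faceAt h ↔ j = k := by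
  constructor
  · intro e
    simp only [faceAt, mk.injEq, heq_eq_eq, true_and] at e
    exact c.π.face_injective e
  · rintro rfl
    rfl

/-- A single face index yields the source, so nothing can cancel its sign: this is the regularity of
the vectors. -/
lemma δ_simplex_eq_faceAt_iff {c : SPathCode X Y (n + 1)} {j k : Fin (n + 2)}
    (h : c.π.FirstEventBend k) :
    (X ⊗ Y : SSet.{u}).δ j c.simplex = (c.faceAt h).simplex ↔ j = k := by
  constructor
  · intro e
    rcases eq_of_δ_simplex_eq e with hlt | ⟨hI, e'⟩
    · exact absurd hlt (lt_irrefl _)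
    · exact mk_face_eq_faceAt_iff.1 e'.symm
  · rintro rfl
    exact c.π.δ_simplex j _ _

/-- The rank which decreases along the paths of the Eilenberg-Zilber vector field. -/
def rank (c : SPathCode X Y n) : ℕ := (n + 1) * (c.p + c.q + 1) ^ 2 + c.π.weight

/-- With `s` the smaller total dimension, the quadratic term drops by at least `(n + 1)(2s + 3)`,
more than the bound `(n + 1)s` on the weight. The rank thus orders cells by dimension of the prism
before weight. -/
lemma rank_lt_of_dim_lt {c c' : SPathCode X Y n} (h : c'.p + c'.q < c.p + c.q) :
    c'.rank < c.rank := by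
  have h1 := c'.π.weight_le
  have h2 : (n + 1) * (c'.p + c'.q + 2) ^ 2 ≤ (n + 1) * (c.p + c.q + 1) ^ 2 :=
    Nat.mul_le_mul_left _ (Nat.pow_le_pow_left (by omega) 2)
  have h3 : (n + 1) * (c'.p + c'.q + 2) ^ 2 = (n + 1) * (c'.p + c'.q + 1) ^ 2 +
      2 * ((n + 1) * (c'.p + c'.q)) + 3 * (n + 1) := by ring
  unfold rank
  omega

lemma rank_lt_rank_faceAt {c : SPathCode X Y (n + 1)} {k : Fin (n + 2)}
    (h : c.π.FirstEventBend k) {c' : SPathCode X Y n} (hs : c'.π.IsSource)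
    (hne : c' ≠ c.faceAt h) {j : Fin (n + 2)}
    (e : (X ⊗ Y : SSet.{u}).δ j c.simplex = c'.simplex) : c'.rank < (c.faceAt h).rank := by
  rcases eq_of_δ_simplex_eq e with hlt | ⟨hI, rfl⟩
  · exact rank_lt_of_dim_lt hlt
  · have hjk : j ≠ k := fun e => hne (mk_face_eq_faceAt_iff.2 e)
    exact Nat.add_lt_add_left (h.weight_face_lt c.interior hjk hI hs) _

end SPathCode

/-! ### The vector field read through codes -/

section EZ

variable {X Y : SSet.{u}} {n : ℕ}

open SPathCode AlgCellComplex

lemma ezVectorField_iff {ρ : (X ⊗ Y : SSet.{u}).nonDegenerate n}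
    {ρ' : (X ⊗ Y : SSet.{u}).nonDegenerate (n + 1)} : ezVectorField X Y n ρ ρ' ↔
      ∃ k, ∃ h : (ofNonDegenerate ρ').π.FirstEventBend k,
        ofNonDegenerate ρ = (ofNonDegenerate ρ').faceAt h := by
  constructor
  · rintro ⟨p, q, σ, τ, π, k, hπ, hk, e', e⟩
    rw [ofNonDegenerate_eq (c := ⟨p, q, σ, τ, π, hπ⟩) e'.symm]
    exact ⟨k, hk, ofNonDegenerate_eq e.symm⟩
  · rintro ⟨k, hk, e⟩
    exact ⟨_, _, _, _, _, k, (ofNonDegenerate ρ').interior, hk,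
      (simplex_ofNonDegenerate ρ').symm, by
        rw [← simplex_ofNonDegenerate ρ, e]
        rfl⟩

lemma mem_sources_ezVectorField {ρ : (X ⊗ Y : SSet.{u}).nonDegenerate n} :
    ρ ∈ sources (ezVectorField X Y) n ↔ (ofNonDegenerate ρ).π.IsSource := by
  constructor
  · rintro ⟨ρ', h⟩
    obtain ⟨k, hk, e⟩ := ezVectorField_iff.1 h
    rw [e]
    exact isSource_faceAt _ hk
  · intro h
    obtain ⟨π', k, hπ', hk, e⟩ := h.exists_face_eq (ofNonDegenerate ρ).interior
    let c : SPathCode X Y (n + 1) := ⟨_, _, (ofNonDegenerate ρ).σ, (ofNonDegenerate ρ).τ, π', hπ'⟩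
    refine ⟨⟨c.simplex, c.simplex_mem_nonDegenerate⟩, _, _, c.σ, c.τ, π', k, hπ', hk, rfl, ?_⟩
    rw [e]
    exact (simplex_ofNonDegenerate ρ).symm

lemma mem_targets_ezVectorField {ρ : (X ⊗ Y : SSet.{u}).nonDegenerate n} :
    ρ ∈ targets (ezVectorField X Y) n ↔ (ofNonDegenerate ρ).π.IsTarget := by
  obtain _ | n := n
  · refine ⟨fun h => h.elim, ?_⟩
    rintro ⟨k, ⟨i, -⟩, -⟩
    exact i.elim0
  · constructor
    · rintro ⟨ρ', h⟩
      obtain ⟨k, hk, -⟩ := ezVectorField_iff.1 h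
      exact ⟨k, hk⟩
    · rintro ⟨k, hk⟩
      let c := (ofNonDegenerate ρ).faceAt hk
      exact ⟨⟨c.simplex, c.simplex_mem_nonDegenerate⟩,
        ezVectorField_iff.2 ⟨k, hk, ofNonDegenerate_eq rfl⟩⟩

lemma mem_criticals_ezVectorField {ρ : (X ⊗ Y : SSet.{u}).nonDegenerate n} :
    ρ ∈ criticals (ezVectorField X Y) n ↔ (ofNonDegenerate ρ).π.IsCritical := by
  have h : ρ ∈ criticals (ezVectorField X Y) n ↔
      ¬ (ρ ∈ sources (ezVectorField X Y) n ∨ ρ ∈ targets (ezVectorField X Y) n) := Iff.rfl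
  rw [h, mem_sources_ezVectorField, mem_targets_ezVectorField]
  have h1 := (ofNonDegenerate ρ).π.isSource_or_isTarget_or_isCritical
  have h2 := (ofNonDegenerate ρ).π.not_isSource_and_isCritical
  have h3 := (ofNonDegenerate ρ).π.not_isTarget_and_isCritical
  tauto

lemma exists_δ_eq_of_isFace {Z : SSet.{u}} {ρ : Z.nonDegenerate n}
    {ρ' : Z.nonDegenerate (n + 1)} (h : (Z.normalizedACC ℤ).IsFace (p := n) ρ ρ') :
    ∃ j, Z.δ j ρ'.1 = ρ.1 := by
  classical
  obtain ⟨j, -, hj⟩ := Finset.exists_ne_zero_of_sum_ne_zero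
    ((Z.incidence_normalizedACC ρ ρ').symm.trans_ne h)
  exact ⟨j, by_contra fun hne => hj (if_neg hne)⟩

lemma exists_incidence_eq_of_ezVectorField {ρ : (X ⊗ Y : SSet.{u}).nonDegenerate n}
    {ρ' : (X ⊗ Y : SSet.{u}).nonDegenerate (n + 1)} (h : ezVectorField X Y n ρ ρ') :
    ∃ k : ℕ, (-1) ^ k = (SSet.normalizedACC ℤ (X ⊗ Y)).incidence (p := n) ρ ρ' := by
  classical
  obtain ⟨k, hk, e⟩ := ezVectorField_iff.1 h
  refine ⟨k, ?_⟩
  rw [SSet.incidence_normalizedACC, Finset.sum_eq_single k]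
  · rw [← simplex_ofNonDegenerate ρ, ← simplex_ofNonDegenerate ρ', e,
      if_pos ((δ_simplex_eq_faceAt_iff hk).2 rfl)]
  · intro j _ hj
    rw [← simplex_ofNonDegenerate ρ, ← simplex_ofNonDegenerate ρ', e,
      if_neg (mt (δ_simplex_eq_faceAt_iff hk).1 hj)]
  · exact fun hk => absurd (Finset.mem_univ k) hk

lemma isDiscreteVectorField_ezVectorField (X Y : SSet.{u}) :
    IsDiscreteVectorField (ezVectorField X Y) where
  regular n ρ ρ' h := by
    obtain ⟨k, hk⟩ := exists_incidence_eq_of_ezVectorField h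
    have := neg_one_pow_eq_or ℤ k
    rwa [hk] at this
  target_unique n ρ ρ₁ ρ₂ h₁ h₂ := by
    obtain ⟨k₁, hk₁, e₁⟩ := ezVectorField_iff.1 h₁
    obtain ⟨k₂, hk₂, e₂⟩ := ezVectorField_iff.1 h₂
    refine ofNonDegenerate_injective ?_
    rw [e₁] at e₂
    generalize ofNonDegenerate ρ₁ = c₁ at *
    generalize ofNonDegenerate ρ₂ = c₂ at *
    obtain ⟨p, q, σ, τ, π, hπ⟩ := c₁
    obtain ⟨p', q', σ', τ', π', hπ'⟩ := c₂
    simp only [faceAt, SPathCode.mk.injEq] at e₂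
    obtain ⟨rfl, rfl, rfl, rfl, e⟩ := e₂
    rw [heq_eq_eq] at e
    -- The common face remembers where the bend was: its first event is the diagonal step `k - 1`.
    -- Both bends thus have the same index, and the face then determines the s-path.
    obtain ⟨-, i, hi, hd⟩ := hk₁.face hπ
    obtain ⟨-, i', hi', hd'⟩ := hk₂.face hπ'
    dsimp only at hd hd' hi hi'
    rw [e] at hd
    obtain rfl := hd.unique hd'
    obtain rfl : k₁ = k₂ := Fin.ext (hi.symm.trans hi')
    obtain rfl := hk₁.eq_of_face_eq hk₂ e
    rfl
  source_unique n ρ₁ ρ₂ ρ' h₁ h₂ := by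
    obtain ⟨k₁, hk₁, e₁⟩ := ezVectorField_iff.1 h₁
    obtain ⟨k₂, hk₂, e₂⟩ := ezVectorField_iff.1 h₂
    obtain rfl := hk₁.unique hk₂
    exact ofNonDegenerate_injective (e₁.trans e₂.symm)
  disjoint n := Set.disjoint_left.2 fun ρ hs ht =>
    SPath.not_isSource_and_isTarget _
      ⟨mem_sources_ezVectorField.1 hs, mem_targets_ezVectorField.1 ht⟩

lemma rank_lt_of_isFace {ρ ρ₁ : (X ⊗ Y : SSet.{u}).nonDegenerate n}
    {ρ' : (X ⊗ Y : SSet.{u}).nonDegenerate (n + 1)} (h : ezVectorField X Y n ρ ρ')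
    (hs : ρ₁ ∈ sources (ezVectorField X Y) n)
    (hf : (SSet.normalizedACC ℤ (X ⊗ Y)).IsFace (p := n) ρ₁ ρ') (hne : ρ₁ ≠ ρ) :
    (ofNonDegenerate ρ₁).rank < (ofNonDegenerate ρ).rank := by
  obtain ⟨k, hk, e⟩ := ezVectorField_iff.1 h
  obtain ⟨j, hj⟩ := exists_δ_eq_of_isFace hf
  rw [e]
  refine rank_lt_rank_faceAt hk (mem_sources_ezVectorField.1 hs) 
    (fun e' => hne (ofNonDegenerate_injective (e'.trans e.symm))) (j := j) ?_
  rw [simplex_ofNonDegenerate, simplex_ofNonDegenerate, hj]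

end EZ

/-! ### Elements of a tensor product of chain complexes -/

section Tensor

variable {k : Type} [CommRing k] (K L : ChainComplex (ModuleCat.{u} k) ℕ)

/-- The inclusion of a summand of the tensor product of two chain complexes. -/
noncomputable def tensorIncl {p q n : ℕ} (h : p + q = n) :
    (K.X p ⊗[k] L.X q) →ₗ[k] (tensorComplex K L).X n :=
  (HomologicalComplex.ιMapBifunctor K L (tensorBifunctor k) (ComplexShape.down ℕ) p q n h).hom

/-- The element `x ⊗ y` in degree `n = p + q` of the tensor product of two chain complexes. -/
noncomputable def tmulDeg {p q n : ℕ} (h : p + q = n) (x : K.X p) (y : L.X q) :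
    (tensorComplex K L).X n :=
  tensorIncl K L h (x ⊗ₜ[k] y)

lemma tmulDeg_smul_sum_left {p q n : ℕ} (h : p + q = n) {ι : Type} (s : Finset ι) (r : ι → ℤ)
    (x : ι → K.X p) (y : L.X q) :
    tmulDeg K L h (∑ i ∈ s, r i • x i) y = ∑ i ∈ s, r i • tmulDeg K L h (x i) y := by
  simp only [tmulDeg, TensorProduct.sum_tmul, map_sum]
  refine Finset.sum_congr rfl fun i _ => ?_
  rw [← map_zsmul, TensorProduct.smul_tmul']

lemma tmulDeg_smul_sum_right {p q n : ℕ} (h : p + q = n) {ι : Type} (s : Finset ι) (r : ι → ℤ)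
    (x : K.X p) (y : ι → L.X q) :
    tmulDeg K L h x (∑ i ∈ s, r i • y i) = ∑ i ∈ s, r i • tmulDeg K L h x (y i) := by
  simp only [tmulDeg, TensorProduct.tmul_sum, map_sum]
  refine Finset.sum_congr rfl fun i _ => ?_
  rw [← map_zsmul, TensorProduct.tmul_smul]

lemma tmulDeg_zero_left {p q n : ℕ} (h : p + q = n) (y : L.X q) :
    tmulDeg K L h 0 y = 0 := by
  rw [tmulDeg, TensorProduct.zero_tmul, map_zero]

lemma tmulDeg_zero_right {p q n : ℕ} (h : p + q = n) (x : K.X p) :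
    tmulDeg K L h x 0 = 0 := by
  rw [tmulDeg, TensorProduct.tmul_zero, map_zero]

open HomologicalComplex

lemma D₁_tmulDeg_zero {q n m : ℕ} (h : 0 + q = n) (x : K.X 0) (y : L.X q) :
    (mapBifunctor.D₁ K L (tensorBifunctor k) (ComplexShape.down ℕ) n m).hom
      (tmulDeg K L h x y) = 0 := by
  have := mapBifunctor.ι_D₁ K L (tensorBifunctor k) (ComplexShape.down ℕ) n m 0 q h
  rw [mapBifunctor.d₁_eq_zero _ _ _ _ _ _ _ (by simp)] at this
  exact congrArg (fun f => f.hom (x ⊗ₜ[k] y)) this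

lemma D₂_tmulDeg_zero {p n m : ℕ} (h : p + 0 = n) (x : K.X p) (y : L.X 0) :
    (mapBifunctor.D₂ K L (tensorBifunctor k) (ComplexShape.down ℕ) n m).hom
      (tmulDeg K L h x y) = 0 := by
  have := mapBifunctor.ι_D₂ K L (tensorBifunctor k) (ComplexShape.down ℕ) n m p 0 h
  rw [mapBifunctor.d₂_eq_zero _ _ _ _ _ _ _ (by simp)] at this
  exact congrArg (fun f => f.hom (x ⊗ₜ[k] y)) this

/-- The degrees `n` and `m` are free variables tied by equations, so `p + 1 + q` and `p + q + 1`
need no transport. -/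
lemma D₁_tmulDeg_succ {p q n m : ℕ} (h : p + 1 + q = n) (h' : p + q = m) (x : K.X (p + 1))
    (y : L.X q) :
    (mapBifunctor.D₁ K L (tensorBifunctor k) (ComplexShape.down ℕ) n m).hom
      (tmulDeg K L h x y) = tmulDeg K L h' ((K.d (p + 1) p).hom x) y := by
  have := mapBifunctor.ι_D₁ K L (tensorBifunctor k) (ComplexShape.down ℕ) n m (p + 1) q h
  rw [mapBifunctor.d₁_eq K L (tensorBifunctor k) (ComplexShape.down ℕ)
    (show (ComplexShape.down ℕ).Rel (p + 1) p from rfl) q m h',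
    show ComplexShape.ε₁ (ComplexShape.down ℕ) (ComplexShape.down ℕ) (ComplexShape.down ℕ)
      (p + 1, q) = 1 from rfl, one_smul] at this
  exact congrArg (fun f => f.hom (x ⊗ₜ[k] y)) this

lemma D₂_tmulDeg_succ {p q n m : ℕ} (h : p + (q + 1) = n) (h' : p + q = m) (x : K.X p)
    (y : L.X (q + 1)) :
    (mapBifunctor.D₂ K L (tensorBifunctor k) (ComplexShape.down ℕ) n m).hom
      (tmulDeg K L h x y) = (-1 : ℤ) ^ p • tmulDeg K L h' x ((L.d (q + 1) q).hom y) := by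
  have := mapBifunctor.ι_D₂ K L (tensorBifunctor k) (ComplexShape.down ℕ) n m p (q + 1) h
  rw [mapBifunctor.d₂_eq K L (tensorBifunctor k) (ComplexShape.down ℕ)
    p (show (ComplexShape.down ℕ).Rel (q + 1) q from rfl) m h'] at this
  refine (congrArg (fun f => f.hom (x ⊗ₜ[k] y)) this).trans ?_
  simp
  rfl

end Tensor

/-! ### The Alexander-Whitney map -/

/-- The inclusion of the first `P + 1` vertices. -/
def frontMap (P n : ℕ) : ⦋P⦌ ⟶ ⦋n⦌ :=
  SimplexCategory.mkHom ⟨fun i => ⟨min (i : ℕ) n, by omega⟩, fun i j h => by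
    have : (i : ℕ) ≤ j := h
    simp only [Fin.mk_le_mk]
    omega⟩

/-- The inclusion of the last `Q + 1` vertices. -/
def backMap (Q n : ℕ) : ⦋Q⦌ ⟶ ⦋n⦌ :=
  SimplexCategory.mkHom ⟨fun i => ⟨min ((i : ℕ) + (n - Q)) n, by omega⟩, fun i j h => by
    have : (i : ℕ) ≤ j := h
    simp only [Fin.mk_le_mk]
    omega⟩

lemma frontMap_apply (P n : ℕ) (i : Fin (P + 1)) : (frontMap P n i : ℕ) = min (i : ℕ) n := rfl

lemma backMap_apply (Q n : ℕ) (i : Fin (Q + 1)) :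
    (backMap Q n i : ℕ) = min ((i : ℕ) + (n - Q)) n := rfl

lemma SimplexCategory.hom_ext_val {n m : ℕ} {f g : ⦋n⦌ ⟶ ⦋m⦌}
    (h : ∀ i : Fin (n + 1), (f i : Fin (m + 1)).val = (g i : Fin (m + 1)).val) : f = g := by
  ext i : 3
  exact Fin.ext (h i)

lemma SimplexCategory.comp_δ_val {n m : ℕ} (f : ⦋n⦌ ⟶ ⦋m⦌) (j : Fin (m + 2)) (i : Fin (n + 1)) :
    ((f ≫ SimplexCategory.δ j) i : Fin (m + 2)).val =
      if (f i : Fin (m + 1)).val < j then (f i : Fin (m + 1)).val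
        else (f i : Fin (m + 1)).val + 1 := by
  have : (f ≫ SimplexCategory.δ j) i = j.succAbove (f i) := rfl
  rw [this, Fin.succAbove]
  simp only [Fin.lt_def, Fin.val_castSucc]
  split_ifs <;> rfl

lemma SimplexCategory.δ_comp_val {n m : ℕ} (j : Fin (n + 2)) (f : ⦋n + 1⦌ ⟶ ⦋m⦌)
    (i : Fin (n + 1)) :
    ((SimplexCategory.δ j ≫ f) i : Fin (m + 1)) = f (j.succAbove i) := rfl

lemma Fin.val_succAbove' {n : ℕ} (j : Fin (n + 1)) (i : Fin n) :
    (j.succAbove i : ℕ) = if (i : ℕ) < j then (i : ℕ) else i + 1 := by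
  rw [Fin.succAbove]
  simp only [Fin.lt_def, Fin.val_castSucc]
  split_ifs <;> rfl

/-! ### Front and back faces against the coface maps -/

lemma frontMap_comp_δ_of_le {P n : ℕ} (hP : P ≤ n) {j : Fin (n + 2)} {j' : Fin (P + 2)}
    (h : (j : ℕ) = j') :
    frontMap P n ≫ SimplexCategory.δ j = SimplexCategory.δ j' ≫ frontMap (P + 1) (n + 1) := by
  refine SimplexCategory.hom_ext_val fun i => ?_
  rw [SimplexCategory.comp_δ_val, SimplexCategory.δ_comp_val, frontMap_apply, frontMap_apply,
    Fin.val_succAbove']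
  have := i.2
  split_ifs <;> omega

lemma backMap_comp_δ_of_le {P Q n : ℕ} (hn : P + Q = n) {j : Fin (n + 2)}
    (hj : (j : ℕ) ≤ P) : backMap Q n ≫ SimplexCategory.δ j = backMap Q (n + 1) := by
  refine SimplexCategory.hom_ext_val fun i => ?_
  rw [SimplexCategory.comp_δ_val, backMap_apply, backMap_apply]
  have := i.2
  split_ifs <;> omega

lemma frontMap_comp_δ_of_gt {P n : ℕ} (hP : P ≤ n) {j : Fin (n + 2)}
    (hj : P < (j : ℕ)) : frontMap P n ≫ SimplexCategory.δ j = frontMap P (n + 1) := by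
  refine SimplexCategory.hom_ext_val fun i => ?_
  rw [SimplexCategory.comp_δ_val, frontMap_apply, frontMap_apply]
  have := i.2
  split_ifs <;> omega

lemma backMap_comp_δ_of_gt {P Q n : ℕ} (hn : P + Q = n) {j : Fin (n + 2)} {l : Fin (Q + 2)}
    (h : (j : ℕ) = P + l) :
    backMap Q n ≫ SimplexCategory.δ j = SimplexCategory.δ l ≫ backMap (Q + 1) (n + 1) := by
  refine SimplexCategory.hom_ext_val fun i => ?_
  rw [SimplexCategory.comp_δ_val, SimplexCategory.δ_comp_val, backMap_apply, backMap_apply,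
    Fin.val_succAbove']
  have := i.2
  split_ifs <;> omega

/-- With `δ_zero_comp_backMap`, this identifies the last face of the longer front with the zeroth
face of the longer back: the two extra terms that cancel in the Leibniz formula. -/
lemma δ_last_comp_frontMap (P n : ℕ) :
    SimplexCategory.δ (Fin.last (P + 1)) ≫ frontMap (P + 1) (n + 1) = frontMap P (n + 1) := by
  refine SimplexCategory.hom_ext_val fun i => ?_
  rw [SimplexCategory.δ_comp_val, frontMap_apply, frontMap_apply, Fin.val_succAbove']
  have := i.2
  rw [Fin.val_last, if_pos (by omega)]

lemma δ_zero_comp_backMap {Q n : ℕ} (hQ : Q ≤ n) :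
    SimplexCategory.δ (0 : Fin (Q + 2)) ≫ backMap (Q + 1) (n + 1) = backMap Q (n + 1) := by
  refine SimplexCategory.hom_ext_val fun i => ?_
  rw [SimplexCategory.δ_comp_val, backMap_apply, backMap_apply, Fin.val_succAbove']
  have := i.2
  simp only [Fin.val_zero, Nat.not_lt_zero, if_false]
  omega

section AW

variable {X Y : SSet.{u}}

lemma SSet.map_δ {n m : ℕ} (f : ⦋m⦌ ⟶ ⦋n⦌) (j : Fin (n + 2)) (x : X _⦋n + 1⦌) :
    X.map f.op (X.δ j x) = X.map (f ≫ SimplexCategory.δ j).op x := by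
  rw [op_comp, Functor.map_comp, comp_apply]
  rfl

lemma SSet.δ_map {n m : ℕ} (f : ⦋m + 1⦌ ⟶ ⦋n⦌) (j : Fin (m + 2)) (x : X _⦋n⦌) :
    X.δ j (X.map f.op x) = X.map (SimplexCategory.δ j ≫ f).op x := by
  rw [op_comp, Functor.map_comp, comp_apply]
  rfl

/-- The combinatorial identity behind the compatibility of the Alexander-Whitney map with the
differentials. -/
lemma sum_front_back_δ {M : Type*} [AddCommGroup M] {P Q n : ℕ} (hn : P + Q = n)
    (T : X _⦋P⦌ → Y _⦋Q⦌ → M) (x : X _⦋n + 1⦌) (y : Y _⦋n + 1⦌) :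
    ∑ j : Fin (n + 2), (-1 : ℤ) ^ (j : ℕ) •
        T (X.map (frontMap P n).op (X.δ j x)) (Y.map (backMap Q n).op (Y.δ j y)) =
      ∑ j : Fin (P + 2), (-1 : ℤ) ^ (j : ℕ) •
        T (X.δ j (X.map (frontMap (P + 1) (n + 1)).op x)) (Y.map (backMap Q (n + 1)).op y) +
      (-1 : ℤ) ^ P • ∑ l : Fin (Q + 2), (-1 : ℤ) ^ (l : ℕ) •
        T (X.map (frontMap P (n + 1)).op x) (Y.δ l (Y.map (backMap (Q + 1) (n + 1)).op y)) := by
  simp only [SSet.map_δ, SSet.δ_map]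
  -- The first `P + 1` faces act on the front part and the last `Q + 1` on the back part.
  rw [← (finCongr (by omega : (P + 1) + (Q + 1) = n + 2)).sum_comp, Fin.sum_univ_add,
    Fin.sum_univ_castSucc (n := P + 1), Fin.sum_univ_succ (n := Q + 1)]
  have h1 (j : Fin (P + 1)) : (-1 : ℤ) ^ (finCongr (by omega : (P + 1) + (Q + 1) = n + 2)
      (Fin.castAdd (Q + 1) j) : ℕ) •
      T (X.map (frontMap P n ≫ SimplexCategory.δ
        (finCongr (by omega) (Fin.castAdd (Q + 1) j))).op x)
        (Y.map (backMap Q n ≫ SimplexCategory.δ (finCongr (by omega) (Fin.castAdd (Q + 1) j))).op y)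
      = (-1 : ℤ) ^ (j.castSucc : ℕ) •
      T (X.map (SimplexCategory.δ j.castSucc ≫ frontMap (P + 1) (n + 1)).op x)
        (Y.map (backMap Q (n + 1)).op y) := by
    rw [frontMap_comp_δ_of_le (j' := j.castSucc) (by omega) (by simp),
      backMap_comp_δ_of_le hn (by simp; omega)]
    simp
  have h2 (l : Fin (Q + 1)) : (-1 : ℤ) ^ (finCongr (by omega : (P + 1) + (Q + 1) = n + 2)
      (Fin.natAdd (P + 1) l) : ℕ) •
      T (X.map (frontMap P n ≫ SimplexCategory.δ (finCongr (by omega) (Fin.natAdd (P + 1) l))).op x)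
        (Y.map (backMap Q n ≫ SimplexCategory.δ (finCongr (by omega) (Fin.natAdd (P + 1) l))).op y)
      = (-1 : ℤ) ^ P • (-1 : ℤ) ^ (l.succ : ℕ) •
      T (X.map (frontMap P (n + 1)).op x)
        (Y.map (SimplexCategory.δ l.succ ≫ backMap (Q + 1) (n + 1)).op y) := by
    rw [frontMap_comp_δ_of_gt (by omega) (by simp; omega),
      backMap_comp_δ_of_gt (l := l.succ) hn (by simp; omega), smul_smul, ← pow_add]
    congr 2
    simp
    omega
  rw [Finset.sum_congr rfl fun j _ => h1 j, Finset.sum_congr rfl fun l _ => h2 l,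
    δ_last_comp_frontMap, δ_zero_comp_backMap (by omega), smul_add, Finset.smul_sum,
    Fin.val_last, Fin.val_zero, pow_succ]
  simp

variable (k : Type) [CommRing k]

/-- The component of bidegree `(P, Q)` of the Alexander-Whitney map. -/
noncomputable def awTerm (n : ℕ) (x : X _⦋n⦌) (y : Y _⦋n⦌) (P Q : ℕ) :
    (tensorComplex (X.normalizedChainComplex (SSet.coeff.{u} k))
      (Y.normalizedChainComplex (SSet.coeff.{u} k))).X n :=
  if h : P + Q = n then
    tmulDeg (X.normalizedChainComplex (SSet.coeff.{u} k))
      (Y.normalizedChainComplex (SSet.coeff.{u} k)) h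
      (X.normGen k (X.map (frontMap P n).op x)) (Y.normGen k (Y.map (backMap Q n).op y))
  else 0

/-- The Alexander-Whitney map on simplices. -/
noncomputable def awSum (n : ℕ) (x : X _⦋n⦌) (y : Y _⦋n⦌) :
    (tensorComplex (X.normalizedChainComplex (SSet.coeff.{u} k))
      (Y.normalizedChainComplex (SSet.coeff.{u} k))).X n :=
  ∑ pq ∈ Finset.HasAntidiagonal.antidiagonal n, awTerm k n x y pq.1 pq.2

lemma d_awSum (n : ℕ) (x : X _⦋n + 1⦌) (y : Y _⦋n + 1⦌) :
    ((tensorComplex (X.normalizedChainComplex (SSet.coeff.{u} k))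
      (Y.normalizedChainComplex (SSet.coeff.{u} k))).d (n + 1) n).hom
      (awSum k (n + 1) x y) =
      ∑ j : Fin (n + 2), (-1 : ℤ) ^ (j : ℕ) • awSum k n (X.δ j x) (Y.δ j y) := by
  rw [HomologicalComplex.mapBifunctor.d_eq, ModuleCat.hom_add, LinearMap.add_apply]
  simp only [awSum, map_sum, Finset.smul_sum]
  -- The bidegree `(P, Q)` receives `D₁` from `(P + 1, Q)` and `D₂` from `(P, Q + 1)`; the split-off
  -- extreme terms have no differential in that direction.
  rw [Finset.Nat.sum_antidiagonal_succ, Finset.Nat.sum_antidiagonal_succ', Finset.sum_comm]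
  have z1 : (HomologicalComplex.mapBifunctor.D₁ (X.normalizedChainComplex (SSet.coeff.{u} k))
      (Y.normalizedChainComplex (SSet.coeff.{u} k)) (tensorBifunctor k)
      (ComplexShape.down ℕ) (n + 1) n).hom
        (awTerm k (n + 1) x y 0 (n + 1)) = 0 := by
    rw [awTerm, dif_pos (by omega), D₁_tmulDeg_zero]
  have z2 : (HomologicalComplex.mapBifunctor.D₂ (X.normalizedChainComplex (SSet.coeff.{u} k))
      (Y.normalizedChainComplex (SSet.coeff.{u} k)) (tensorBifunctor k)
      (ComplexShape.down ℕ) (n + 1) n).hom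
        (awTerm k (n + 1) x y (n + 1) 0) = 0 := by
    rw [awTerm, dif_pos (by omega), D₂_tmulDeg_zero]
  rw [z1, z2, zero_add, zero_add, ← Finset.sum_add_distrib]
  refine Finset.sum_congr rfl fun ⟨P, Q⟩ hPQ => ?_
  have hn : P + Q = n := Finset.HasAntidiagonal.mem_antidiagonal.1 hPQ
  dsimp only
  simp only [awTerm]
  rw [dif_pos (by omega : P + 1 + Q = n + 1), dif_pos (by omega : P + (Q + 1) = n + 1),
    D₁_tmulDeg_succ _ _ _ hn, D₂_tmulDeg_succ _ _ _ hn]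
  simp only [dif_pos hn]
  rw [sum_front_back_δ hn fun a b => tmulDeg (X.normalizedChainComplex (SSet.coeff.{u} k))
    (Y.normalizedChainComplex (SSet.coeff.{u} k)) hn (X.normGen k a) (Y.normGen k b)]
  congr 1
  · exact (congrArg (fun z => tmulDeg (X.normalizedChainComplex (SSet.coeff.{u} k))
    (Y.normalizedChainComplex (SSet.coeff.{u} k)) hn z
      (Y.normGen k (Y.map (backMap Q (n + 1)).op y))) (X.d_normGen k _)).trans
      (tmulDeg_smul_sum_left _ _ _ _ _ _ _)
  · congr 1
    exact (congrArg (fun z => tmulDeg (X.normalizedChainComplex (SSet.coeff.{u} k))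
      (Y.normalizedChainComplex (SSet.coeff.{u} k)) hn
      (X.normGen k (X.map (frontMap P (n + 1)).op x)) z) (Y.d_normGen k _)).trans
      (tmulDeg_smul_sum_right _ _ _ _ _ _ _)

end AW

/-! ### Alexander-Whitney on normalized chains, targets and last simplices -/

section AlexanderWhitney

variable {X Y : SSet.{u}} (k : Type) [CommRing k]

lemma SSet.map_mem_degenerate {n m : ℕ} {f : ⦋n⦌ ⟶ ⦋m⦌} {i : Fin n} (h : f i.castSucc = f i.succ)
    (x : X _⦋m⦌) : X.map f.op x ∈ X.degenerate n := by
  obtain _ | n := n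
  · exact i.elim0
  · obtain ⟨f', rfl⟩ := SimplexCategory.eq_σ_comp_of_not_injective' f i h
    rw [op_comp, Functor.map_comp, comp_apply]
    exact X.σ_mem_degenerate i _

/-- For `i < P` the identified vertices `i` and `i + 1` both belong to the front face, which is
therefore degenerate. -/
lemma awTerm_eq_zero_of_front {n m : ℕ} {f : ⦋n⦌ ⟶ ⦋m⦌} (x : X _⦋m⦌) (y : Y _⦋n⦌) {P Q : ℕ}
    {i : Fin n} (h : f i.castSucc = f i.succ) (hi : (i : ℕ) < P) :
    awTerm k n (X.map f.op x) y P Q = 0 := by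
  rw [awTerm]
  split_ifs with hn
  · have hd : X.map (frontMap P n).op (X.map f.op x) ∈ X.degenerate P := by
      rw [← comp_apply, ← Functor.map_comp, ← op_comp]
      refine SSet.map_mem_degenerate (i := ⟨i, hi⟩) ?_ x
      have e1 : frontMap P n (Fin.castSucc ⟨i, hi⟩) = i.castSucc := Fin.ext (by
        rw [frontMap_apply]
        simp only [Fin.val_castSucc]
        omega)
      have e2 : frontMap P n (Fin.succ ⟨i, hi⟩) = i.succ := Fin.ext (by
        rw [frontMap_apply]
        simp only [Fin.val_succ]
        omega)
      exact (congrArg f e1).trans (h.trans (congrArg f e2).symm)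
    rw [X.normGen_eq_zero k hd, tmulDeg_zero_left]
  · rfl

/-- For `P ≤ i` the identified vertices belong to the back face, where they have the indices `i - P`
and `i - P + 1`. -/
lemma awTerm_eq_zero_of_back {n m : ℕ} {g : ⦋n⦌ ⟶ ⦋m⦌} (x : X _⦋n⦌) (y : Y _⦋m⦌) {P Q : ℕ}
    {i : Fin n} (h : g i.castSucc = g i.succ) (hi : P ≤ (i : ℕ)) :
    awTerm k n x (Y.map g.op y) P Q = 0 := by
  rw [awTerm]
  split_ifs with hn
  · have hd : Y.map (backMap Q n).op (Y.map g.op y) ∈ Y.degenerate Q := by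
      rw [← comp_apply, ← Functor.map_comp, ← op_comp]
      have hQ : (i : ℕ) - P < Q := by omega
      refine SSet.map_mem_degenerate (i := ⟨i - P, hQ⟩) ?_ y
      have e1 : backMap Q n (Fin.castSucc ⟨i - P, hQ⟩) = i.castSucc := Fin.ext (by
        rw [backMap_apply]
        simp only [Fin.val_castSucc]
        omega)
      have e2 : backMap Q n (Fin.succ ⟨i - P, hQ⟩) = i.succ := Fin.ext (by
        rw [backMap_apply]
        simp only [Fin.val_succ]
        omega)
      exact (congrArg g e1).trans (h.trans (congrArg g e2).symm)
    rw [Y.normGen_eq_zero k hd, tmulDeg_zero_right]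
  · rfl

/-- The Alexander-Whitney map is null on the simplices which are degenerate in `X` before some
degeneracy in `Y`. -/
lemma awSum_eq_zero {n m m' : ℕ} {f : ⦋n⦌ ⟶ ⦋m⦌} {g : ⦋n⦌ ⟶ ⦋m'⦌} (x : X _⦋m⦌) (y : Y _⦋m'⦌)
    {i j : Fin n} (hij : i ≤ j) (hf : f i.castSucc = f i.succ) (hg : g j.castSucc = g j.succ) :
    awSum k n (X.map f.op x) (Y.map g.op y) = 0 := by
  refine Finset.sum_eq_zero fun pq _ => ?_
  -- A cut after `i` spoils the front face; a cut at or before `i ≤ j` spoils the back face.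
  rcases Nat.lt_or_ge i pq.1 with h | h
  · exact awTerm_eq_zero_of_front k _ _ hf h
  · exact awTerm_eq_zero_of_back k _ _ hg (h.trans hij)

lemma awSum_degenerate {n : ℕ} {ρ : (X ⊗ Y : SSet.{u}) _⦋n⦌}
    (h : ρ ∈ (X ⊗ Y : SSet.{u}).degenerate n) : awSum k n ρ.1 ρ.2 = 0 := by
  obtain _ | n := n
  · rw [SSet.degenerate_zero] at h
    exact h.elim
  · rw [SSet.degenerate_eq_iUnion_range_σ, Set.mem_iUnion] at h
    obtain ⟨i, ρ, rfl⟩ := h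
    have e : SimplexCategory.σ i i.castSucc = SimplexCategory.σ i i.succ := by
      change i.predAbove i.castSucc = i.predAbove i.succ
      rw [Fin.predAbove_castSucc_self, Fin.predAbove_succ_self]
    exact awSum_eq_zero k ρ.1 ρ.2 le_rfl e e

variable (X Y) in
/-- The Alexander-Whitney map, in degree `n`. -/
noncomputable def awLin (n : ℕ) :
    ((X ⊗ Y : SSet.{u}).normalizedChainComplex (SSet.coeff.{u} k)).X n →ₗ[k]
      (tensorComplex (X.normalizedChainComplex (SSet.coeff.{u} k))
        (Y.normalizedChainComplex (SSet.coeff.{u} k))).X n :=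
  ((X ⊗ Y : SSet.{u}).normBasis k n).constr k fun ρ => awSum k n ρ.1.1 ρ.1.2

/-- The formula also holds on degenerate simplices, as needed for the faces that appear in a
boundary. -/
lemma awLin_normGen {n : ℕ} (ρ : (X ⊗ Y : SSet.{u}) _⦋n⦌) :
    awLin X Y k n ((X ⊗ Y : SSet.{u}).normGen k ρ) = awSum k n ρ.1 ρ.2 := by
  by_cases h : ρ ∈ (X ⊗ Y : SSet.{u}).nonDegenerate n
  · rw [← SSet.normBasis_apply k _ ⟨ρ, h⟩, awLin, Module.Basis.constr_basis]
  · have hd := (SSet.mem_degenerate_iff_notMem_nonDegenerate _ ρ).2 h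
    rw [SSet.normGen_eq_zero k _ hd, map_zero, awSum_degenerate k hd]

variable (X Y) in
/-- The Alexander-Whitney map. -/
noncomputable def awMap :
    (X ⊗ Y : SSet.{u}).normalizedChainComplex (SSet.coeff.{u} k) ⟶
      tensorComplex (X.normalizedChainComplex (SSet.coeff.{u} k))
        (Y.normalizedChainComplex (SSet.coeff.{u} k)) where
  f n := ModuleCat.ofHom (awLin X Y k n)
  comm' := by
    rintro _ n rfl
    refine ModuleCat.hom_ext (((X ⊗ Y : SSet.{u}).normBasis k (n + 1)).ext fun ρ => ?_)
    rw [SSet.normBasis_apply]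
    change ((tensorComplex _ _).d (n + 1) n).hom (awLin X Y k (n + 1) _) =
      awLin X Y k n ((((X ⊗ Y : SSet.{u}).normalizedChainComplex (SSet.coeff.{u} k)).d
        (n + 1) n).hom _)
    rw [awLin_normGen, d_awSum, SSet.d_normGen, map_sum]
    refine Finset.sum_congr rfl fun j _ => ?_
    rw [map_zsmul, awLin_normGen]
    rfl

lemma awSum_simplex_of_isTarget {p q n : ℕ} {π : SPath p q n} (h : π.IsTarget) (σ : X _⦋p⦌)
    (τ : Y _⦋q⦌) : awSum k n (π.simplex σ τ).1 (π.simplex σ τ).2 = 0 := by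
  obtain ⟨l, ⟨i, j, hi, hj, hv, hh⟩, -⟩ := h
  refine awSum_eq_zero k σ τ (i := i) (j := j) ?_ hv hh
  rw [← hj, Fin.ext_iff, Fin.val_succ, Fin.val_castSucc] at hi
  rw [Fin.le_def]
  omega

/-- A cut at `P < p` is followed by a horizontal step, degenerate in `Y`; a cut at `P > p` comes
after the vertical step `p`, degenerate in `X`. At `p` both composites are identities. -/
lemma awSum_simplex_last {p q : ℕ} (σ : X _⦋p⦌) (τ : Y _⦋q⦌) :
    awSum k (p + q) ((SPath.last p q).simplex σ τ).1 ((SPath.last p q).simplex σ τ).2 =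
      tmulDeg (X.normalizedChainComplex (SSet.coeff.{u} k))
        (Y.normalizedChainComplex (SSet.coeff.{u} k)) rfl (X.normGen k σ) (Y.normGen k τ) := by
  change awSum k (p + q) (X.map (SPath.last p q).fst.op σ) (Y.map (SPath.last p q).snd.op τ) = _
  rw [awSum, Finset.sum_eq_single (p, q)]
  · have e1 : frontMap p (p + q) ≫ (SPath.last p q).fst = 𝟙 _ :=
      SimplexCategory.hom_ext_val fun i => by
        change min (frontMap p (p + q) i : ℕ) p = i
        rw [frontMap_apply]
        omega
    have e2 : backMap q (p + q) ≫ (SPath.last p q).snd = 𝟙 _ :=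
      SimplexCategory.hom_ext_val fun i => by
        change (backMap q (p + q) i : ℕ) - p = i
        rw [backMap_apply]
        omega
    rw [awTerm, dif_pos rfl, ← comp_apply, ← Functor.map_comp, ← op_comp, e1, ← comp_apply,
      ← Functor.map_comp, ← op_comp, e2]
    simp
  · rintro ⟨P, Q⟩ hPQ hne
    have hn : P + Q = p + q := Finset.HasAntidiagonal.mem_antidiagonal.1 hPQ
    have hP : P ≠ p := by
      rintro rfl
      exact hne (by rw [show Q = q by omega])
    rcases lt_or_gt_of_ne hP with h | h
    · refine awTerm_eq_zero_of_back k _ _ (i := ⟨P, by omega⟩) (Fin.ext ?_) le_rfl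
      change P - p = P + 1 - p
      omega
    · refine awTerm_eq_zero_of_front k _ _ (i := ⟨p, by omega⟩) (Fin.ext ?_) h
      change min p p = min (p + 1) p
      omega
  · exact fun h => absurd (Finset.HasAntidiagonal.mem_antidiagonal.2 (by rfl)) h

end AlexanderWhitney

/-! ### The critical complex -/

section TensorBasis

variable {X Y : SSet.{u}} (k : Type) [CommRing k] {n : ℕ} {E : Type u}
  (cell : ∀ p q : ℕ, p + q = n → X.nonDegenerate p → Y.nonDegenerate q → E)

/-- The map from the tensor product to the free module generated by cells which correspond to its
generators. -/
noncomputable def tensorToCells :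
    (tensorComplex (X.normalizedChainComplex (SSet.coeff.{u} k))
        (Y.normalizedChainComplex (SSet.coeff.{u} k))).X n ⟶ ModuleCat.of k (E →₀ k) :=
  HomologicalComplex.mapBifunctorDesc fun p q h =>
    ModuleCat.ofHom (((X.normBasis k p).tensorProduct (Y.normBasis k q)).constr k
      fun στ => Finsupp.single (cell p q h στ.1 στ.2) 1)

lemma tensorToCells_tmulDeg {p q : ℕ} (h : p + q = n) (σ : X.nonDegenerate p)
    (τ : Y.nonDegenerate q) :
    (tensorToCells k cell).hom (tmulDeg (X.normalizedChainComplex (SSet.coeff.{u} k))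
        (Y.normalizedChainComplex (SSet.coeff.{u} k)) h (X.normBasis k p σ)
          (Y.normBasis k q τ)) = Finsupp.single (cell p q h σ τ) 1 := by
  have e := HomologicalComplex.ι_mapBifunctorDesc (A := ModuleCat.of k (E →₀ k))
    (K₁ := X.normalizedChainComplex (SSet.coeff.{u} k))
    (K₂ := Y.normalizedChainComplex (SSet.coeff.{u} k)) (F := tensorBifunctor k)
    (c := ComplexShape.down ℕ) (j := n)
    (fun p q h => ModuleCat.ofHom (((X.normBasis k p).tensorProduct (Y.normBasis k q)).constr k
      fun στ => Finsupp.single (cell p q h στ.1 στ.2) 1)) p q h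
  refine (congrArg (fun f => f.hom (X.normBasis k p σ ⊗ₜ[k] Y.normBasis k q τ)) e).trans ?_
  change ((X.normBasis k p).tensorProduct (Y.normBasis k q)).constr k
      (fun στ => Finsupp.single (cell p q h στ.1 στ.2) 1)
        (X.normBasis k p σ ⊗ₜ[k] Y.normBasis k q τ) = _
  rw [← Module.Basis.tensorProduct_apply, Module.Basis.constr_basis]

variable (gen : E → (tensorComplex (X.normalizedChainComplex (SSet.coeff.{u} k))
    (Y.normalizedChainComplex (SSet.coeff.{u} k))).X n)
  (hgen : ∀ p q h σ τ, gen (cell p q h σ τ) =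
    tmulDeg (X.normalizedChainComplex (SSet.coeff.{u} k))
      (Y.normalizedChainComplex (SSet.coeff.{u} k)) h (X.normBasis k p σ) (Y.normBasis k q τ))
  (hsurj : ∀ e, ∃ p q h σ τ, cell p q h σ τ = e)

/-- The identification of the tensor product with the free module generated by cells which
correspond to its generators. -/
noncomputable def tensorEquivOfCells : (E →₀ k) ≃ₗ[k]
    (tensorComplex (X.normalizedChainComplex (SSet.coeff.{u} k))
        (Y.normalizedChainComplex (SSet.coeff.{u} k))).X n :=
  LinearEquiv.ofLinearMap (Finsupp.linearCombination k gen) (tensorToCells k cell).hom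
    (by
      suffices tensorToCells k cell ≫ ModuleCat.ofHom (Finsupp.linearCombination k gen) = 𝟙 _ from
        congrArg ModuleCat.Hom.hom this
      refine HomologicalComplex.mapBifunctor.hom_ext fun p q h => ModuleCat.hom_ext
        (((X.normBasis k p).tensorProduct (Y.normBasis k q)).ext fun στ => ?_)
      rw [Module.Basis.tensorProduct_apply]
      change Finsupp.linearCombination k gen ((tensorToCells k cell).hom (tmulDeg _ _ h _ _)) =
        tmulDeg _ _ h _ _
      rw [tensorToCells_tmulDeg, Finsupp.linearCombination_single, one_smul, hgen])
    (by
      refine Finsupp.lhom_ext' fun c => LinearMap.ext_ring ?_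
      obtain ⟨p, q, h, σ, τ, rfl⟩ := hsurj c
      change (tensorToCells k cell).hom (Finsupp.linearCombination k gen (Finsupp.single _ 1)) =
        Finsupp.single _ 1
      rw [Finsupp.linearCombination_single, one_smul, hgen, tensorToCells_tmulDeg])

lemma tensorEquivOfCells_single (e : E) :
    tensorEquivOfCells k cell gen hgen hsurj (Finsupp.single e 1) = gen e := by
  change Finsupp.linearCombination k gen (Finsupp.single e 1) = gen e
  rw [Finsupp.linearCombination_single, one_smul]

end TensorBasis

section Critical

variable (X Y : SSet.{u})

open AlgCellComplex SPathCode

/-- The critical cell which corresponds to `σ ⊗ τ`. -/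
def critCell {p q n : ℕ} (h : p + q = n) (σ : X.nonDegenerate p) (τ : Y.nonDegenerate q) :
    criticals (ezVectorField X Y) n :=
  h ▸ ⟨⟨_, (⟨p, q, σ, τ, SPath.last p q, SPath.interior_last p q⟩ :
      SPathCode X Y (p + q)).simplex_mem_nonDegenerate⟩,
    mem_criticals_ezVectorField.2 (by
      rw [ofNonDegenerate_eq rfl]
      exact SPath.isCritical_last p q)⟩

variable {X Y}

lemma val_critCell {p q : ℕ} (σ : X.nonDegenerate p) (τ : Y.nonDegenerate q) :
    Subtype.val (p := (· ∈ (X ⊗ Y : SSet.{u}).nonDegenerate (p + q)))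
      (critCell X Y rfl σ τ).1 = (SPath.last p q).simplex σ.1 τ.1 := rfl

lemma exists_critCell_eq {n : ℕ} (c : criticals (ezVectorField X Y) n) :
    ∃ (p q : ℕ) (h : p + q = n) (σ : X.nonDegenerate p) (τ : Y.nonDegenerate q),
      critCell X Y h σ τ = c := by
  obtain ⟨ρ, hρ⟩ := c
  have hc := mem_criticals_ezVectorField.1 hρ
  have e := simplex_ofNonDegenerate ρ
  generalize ofNonDegenerate ρ = c at hc e
  obtain ⟨p, q, σ, τ, π, hπ⟩ := c
  obtain rfl : n = p + q := (hc.coord_eq hπ).1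
  obtain rfl : π = SPath.last p q := SPath.IsCritical.eq_last hc hπ
  exact ⟨p, q, rfl, σ, τ, Subtype.ext (Subtype.ext e)⟩

lemma awMap_critCell {p q n : ℕ} (h : p + q = n) (σ : X.nonDegenerate p) (τ : Y.nonDegenerate q) :
    awLin X Y ℤ n ((X ⊗ Y : SSet.{u}).normBasis ℤ n (critCell X Y h σ τ).1) =
      tmulDeg (X.normalizedChainComplex (SSet.coeff.{u} ℤ))
        (Y.normalizedChainComplex (SSet.coeff.{u} ℤ)) h (X.normBasis ℤ p σ)
          (Y.normBasis ℤ q τ) := by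
  subst h
  rw [SSet.normBasis_apply, SSet.normBasis_apply]
  refine (congrArg (awLin X Y ℤ (p + q)) (SSet.normBasis_apply ℤ (X ⊗ Y)
    (critCell X Y rfl σ τ).1)).trans ((awLin_normGen ℤ _).trans ?_)
  exact awSum_simplex_last ℤ σ.1 τ.1

variable (X Y)

/-- The identification of the critical complex with the tensor product. -/
noncomputable def critIdentification (n : ℕ) : (criticals (ezVectorField X Y) n →₀ ℤ) ≃ₗ[ℤ]
    (tensorComplex (X.normalizedChainComplex (SSet.coeff.{u} ℤ))
        (Y.normalizedChainComplex (SSet.coeff.{u} ℤ))).X n :=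
  tensorEquivOfCells ℤ (fun _ _ h σ τ => critCell X Y h σ τ)
    -- Taking Alexander-Whitney images as generators makes the agreement of the projection with the
    -- identification on critical cells immediate.
    (fun c => awLin X Y ℤ n ((X ⊗ Y : SSet.{u}).normBasis ℤ n c.1))
    (fun _ _ h σ τ => awMap_critCell h σ τ) exists_critCell_eq

lemma critIdentification_single {n : ℕ} (c : criticals (ezVectorField X Y) n) :
    critIdentification X Y n (Finsupp.single c 1) =
      awLin X Y ℤ n ((X ⊗ Y : SSet.{u}).normBasis ℤ n c.1) :=
  tensorEquivOfCells_single ℤ _ _ _ _ c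

lemma awLin_target {n : ℕ} {ρ : (X ⊗ Y : SSet.{u}).nonDegenerate n}
    (h : ρ ∈ targets (ezVectorField X Y) n) :
    awLin X Y ℤ n ((X ⊗ Y : SSet.{u}).normBasis ℤ n ρ) = 0 := by
  rw [SSet.normBasis_apply, awLin_normGen, ← simplex_ofNonDegenerate ρ]
  exact awSum_simplex_of_isTarget ℤ (mem_targets_ezVectorField.1 h) _ _

end Critical

theorem theorem46504 (X Y : SSet.{u}) :
    -- the Eilenberg-Zilber vector field is an admissible discrete vector field
    AlgCellComplex.IsDiscreteVectorField (ezVectorField X Y) ∧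
    AlgCellComplex.IsAdmissible (ezVectorField X Y) ∧
    -- its source, target and critical cells are those described by the s-paths
    (∀ (n : ℕ) (ρ : (X ⊗ Y : SSet.{u}).nonDegenerate n),
      (ρ ∈ AlgCellComplex.sources (ezVectorField X Y) n ↔ HasSPath ρ.1 SPath.IsSource) ∧
      (ρ ∈ AlgCellComplex.targets (ezVectorField X Y) n ↔ HasSPath ρ.1 SPath.IsTarget) ∧
      (ρ ∈ AlgCellComplex.criticals (ezVectorField X Y) n ↔ HasSPath ρ.1 SPath.IsCritical)) ∧
    -- it induces a W-reduction on the tensor product, where the critical cells correspond to the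
    -- generators of the tensor product
    ∃ (φ : CriticalIdentification (ezVectorField X Y)
          (tensorComplex (X.normalizedACC ℤ).complex (Y.normalizedACC ℤ).complex))
      (EZ : Reduction (SSet.normalizedACC ℤ (X ⊗ Y)).complex
          (tensorComplex (X.normalizedACC ℤ).complex (Y.normalizedACC ℤ).complex)),
      (∀ (p q : ℕ) (σ : X.nonDegenerate p) (τ : Y.nonDegenerate q),
        ∃ c : AlgCellComplex.criticals (ezVectorField X Y) (p + q),
          Subtype.val (p := (· ∈ (X ⊗ Y : SSet.{u}).nonDegenerate (p + q))) c.1 =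
              (SPath.last p q).simplex σ.1 τ.1 ∧
            φ (p + q) (Finsupp.single c 1) =
              tmulComplex (X.normalizedACC ℤ).complex (Y.normalizedACC ℤ).complex
                ((X.normalizedACC ℤ).basis p σ) ((Y.normalizedACC ℤ).basis q τ)) ∧
      IsWReduction (SSet.normalizedACC ℤ (X ⊗ Y)) (ezVectorField X Y) φ EZ := by
  refine ⟨isDiscreteVectorField_ezVectorField X Y,
    AlgCellComplex.isAdmissible_of_rank (fun _ ρ => (SPathCode.ofNonDegenerate ρ).rank)
      fun _ _ _ _ h hs hf hne => rank_lt_of_isFace h hs hf hne,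
    fun n ρ => ⟨?_, ?_, ?_⟩, ?_⟩
  · rw [hasSPath_iff, mem_sources_ezVectorField]
  · rw [hasSPath_iff, mem_targets_ezVectorField]
  · rw [hasSPath_iff, mem_criticals_ezVectorField]
  -- Here `L` carries the tensor differential from the start, so the formula for `d'` in
  -- `IsWReduction` says that the critical differential is the standard one.
  · obtain ⟨EZ, hEZ⟩ := AlgCellComplex.exists_wReduction
      (C := SSet.normalizedACC ℤ (X ⊗ Y)) (V := ezVectorField X Y)
      (L := tensorComplex (X.normalizedACC ℤ).complex (Y.normalizedACC ℤ).complex)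
      (isDiscreteVectorField_ezVectorField X Y).disjoint
      (AlgCellComplex.bijective_block_of_rank (isDiscreteVectorField_ezVectorField X Y)
        (fun _ ρ => (SPathCode.ofNonDegenerate ρ).rank)
        fun _ _ _ _ h hs hf hne => rank_lt_of_isFace h hs hf hne)
      (critIdentification X Y) (awMap X Y ℤ) (fun _ _ ht => awLin_target X Y ht)
      (fun _ c => (critIdentification_single X Y c).symm)
    refine ⟨critIdentification X Y, EZ, fun p q σ τ => ⟨critCell X Y rfl σ τ, val_critCell σ τ, ?_⟩,
      hEZ⟩
    exact (critIdentification_single X Y _).trans (awMap_critCell rfl σ τ)
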